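/- Let $R\subset V$ be an irreducible, reduced, finite (crystallographic) root system in a finite dimensional $\mathbb Q$-vector space, with a fixed set of simple roots $\Pi$, highest root $\tilde\alpha$ and weight lattice $X$, and let $\mathbb F$ be a field of characteristic different from $2$. Let $\widehat{\mathcal W}$ be the affine Weyl group, generated by the affine reflections $s_{\alpha,n}(v)=v-(\langle\alpha,v\rangle-n)\alpha^\vee$ of $V^*$ ($\alpha\in R$, $n\in\mathbb Z$). For an affine root $(\alpha,n)\in R\times\mathbb Z$ put $s_{(\alpha,n)}=s_{\alpha,-n}$; it is positive if $n>0$, or $n=0$ and $\alpha>0$; the simple affine roots are $(\alpha,0)$, $\alpha\in\Pi$, and $(-\tilde\alpha,1)$, and their reflections form the set $\widehat{\mathcal S}$ of simple reflections, which defines the Bruhat order. $\widehat{\mathcal W}$ acts on $\widehat X=X\oplus\mathbb Z$ by the action dual to the one on $V^*$. Let $S$ be the symmetric algebra of $\widehat X\otimes_{\mathbb Z}\mathbb F$ and write $\bar\lambda=\lambda\otimes1$. The moment graph $\widehat{\mathcal G}$ has vertex set $\widehat{\mathcal W}$ and an edge $x\to s_\gamma x$, labelled by $\bar\gamma$, whenever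 $\gamma$ is a positive affine root and $x<s_\gamma x$. For $s\in\widehat{\mathcal S}$ the graph $\widehat{\mathcal G}^s$ has as vertices the cosets $\bar x=\{x,xs\}$, and an edge $\bar x\to\bar y$ labelled $\bar\gamma$ whenever $\bar x\neq\bar y$ and some representatives are joined by an edge with label $\bar\gamma$. A sheaf $\mathcal M$ on such a graph consists of $S$-modules $\mathcal M^x$ (stalks) for vertices $x$, $S$-modules $\mathcal M^E$ for edges $E$, killed by the label of $E$, and $S$-linear maps $\rho_{x,E}:\mathcal M^x\to\mathcal M^E$ for $x$ on $E$ (gradings play no role here and are forgotten). For a set $I$ of vertices, $\Gamma(I,\mathcal M)$ is the module of all $m\in\prod_{x\in I}\mathcal M^x$ with $\rho_{x,E}(m_x)=\rho_{y,E}(m_y)$ for all edges $E$ joining $x,y\in I$; $\Gamma(\mathcal M)$ is the module of global sections; and $\mathcal Z(I)$ is the ring of all $z\in\prod_{x\in I}S$ such that $z_x\equiv z_y$ modulo the label of each edge joining $x,y\in I$. For a sheaf $\mathcal M$ on $\widehat{\mathcal G}$, $\vartheta^s_{on}\mathcal M$ is the sheaf on $\widehat{\mathcal G}^s$ with stalks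 $\Gamma(\{x,xs\},\mathcal M)$, whose module at the image $\bar E$ of an edge $E:x\to y$ is the image of $\Gamma(\{y,ys\},\mathcal M)$ in $\mathcal M^E\oplus\mathcal M^{Es}$, with restriction maps induced by those of $\mathcal M$. For a sheaf $\mathcal N$ on $\widehat{\mathcal G}^s$, $\vartheta^s_{out}\mathcal N$ is the sheaf on $\widehat{\mathcal G}$ with stalks $\mathcal N^{\bar x}$, with module $\mathcal N^{\bar x}/l(E)\mathcal N^{\bar x}$ and the natural projections at an edge $E$ with label $l(E)$ joining $x$ and $xs$, and with the module and restriction maps of $\mathcal N$ at $\bar E$ at every other edge $E$. Put $\vartheta^s=\vartheta^s_{out}\circ\vartheta^s_{on}$. Let $\mathbf s=(s_1,\dots,s_l)$, $l\ge 0$, be a sequence in $\widehat{\mathcal S}$, $I(\mathbf s)$ the set of its $2^l$ subsequences (some entries replaced by blanks), $\mathrm{ev}(\sigma)$ the ordered product of the entries of $\sigma\in I(\mathbf s)$, and $J(\mathbf s)=\{\mathrm{ev}(\sigma):\sigma\in I(\mathbf s)\}$. Let $\mathcal B(\mathbf s)=\vartheta^{s_l}\cdots\vartheta^{s_1}\mathcal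 B(e)$, where $\mathcal B(e)$ has stalk $S$ at $e$ and all its other modules are zero. Let $\mathcal X(\mathbf s)\subset\bigoplus_{\sigma\in I(\mathbf s)}S$ be defined by $\mathcal X(\emptyset)=S$ and $\mathcal X(\mathbf s)=\Delta(\mathcal X(\mathbf s'))+c^{\alpha_l}\Delta(\mathcal X(\mathbf s'))$, where $\mathbf s'=(s_1,\dots,s_{l-1})$, $\Delta(f)_\sigma=f_{\sigma'}$ with $\sigma'$ the truncation of $\sigma$ by its last entry, $\alpha_l$ is the simple affine root of $s_l$ and $(c^{\alpha_l}f)_\sigma=\overline{\mathrm{ev}(\sigma)(\alpha_l)}\,f_\sigma$. For $x\in\widehat{\mathcal W}$, let $\mathcal X(\mathbf s)^x$ be the module of the restrictions of the elements of $\mathcal X(\mathbf s)$ to $\{\sigma\in I(\mathbf s):\mathrm{ev}(\sigma)=x\}$. Theorem. Assume that the full subgraph $\widehat{\mathcal G}_{J(\mathbf s)}$ is GKM: the labels of any two distinct edges of it with a common vertex are not proportional. Then $\mathcal X(\mathbf s)$ is stable under the action $(zf)_\sigma=z_{\mathrm{ev}(\sigma)}f_\sigma$ of $\mathcal Z(J(\mathbf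 s))$, and there exist an isomorphism of $\mathcal Z(J(\mathbf s))$-modules $\phi:\Gamma(\mathcal B(\mathbf s))\to\mathcal X(\mathbf s)$ and, for every $x\in\widehat{\mathcal W}$, an isomorphism of $S$-modules $\phi_x:\mathcal B(\mathbf s)^x\to\mathcal X(\mathbf s)^x$ such that $\phi_x(m_x)=\phi(m)|_{\{\sigma\,:\,\mathrm{ev}(\sigma)=x\}}$ for all $m\in\Gamma(\mathcal B(\mathbf s))$ and all $x\in\widehat{\mathcal W}$. -/

import Mathlib

universe u v w

namespace BottSamelson

noncomputable section

open scoped TensorProduct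

/-! ### Labelled graphs, moment graphs, sheaves -/

section Graphs

/-- An oriented graph (multiple edges allowed) whose edges are labelled by nonzero vectors of `VF`.
This is all the structure of a moment graph that enters the notion of a sheaf
(the partial order on the vertices plays no role in it). -/
structure LabelledGraph (F : Type u) [Field F] (VF : Type (max u v)) [AddCommGroup VF]
    [Module F VF] where
  /-- vertices -/
  V : Type v
  /-- edges -/
  E : Type v
  /-- the vertex at which an edge starts -/
  src : E → V
  /-- the vertex at which an edge ends -/
  tgt : E → V
  /-- the labelling -/
  label : E → VF
  label_ne_zero : ∀ e, label e ≠ 0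

/-- A moment graph: a labelled graph with a partial order on the vertices such that an edge from
`x` to `y` forces `x < y`. -/
structure MomentGraph (F : Type u) [Field F] (VF : Type (max u v)) [AddCommGroup VF]
    [Module F VF]
    extends LabelledGraph.{u, v} F VF where
  /-- the partial order on the vertices -/
  order : PartialOrder V
  src_lt_tgt : ∀ e, src e < tgt e

variable {F : Type u} [Field F] {VF : Type (max u v)} [AddCommGroup VF] [Module F VF]

/-- The full subgraph on the vertex set `I` has the GKM property: the labels of two distinct edges
of the subgraph that have a common vertex are not proportional. -/
def LabelledGraph.IsGKMOn (G : LabelledGraph.{u, v} F VF) (I : Set G.V) : Prop :=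
  ∀ e e' : G.E, e ≠ e' → G.src e ∈ I → G.tgt e ∈ I → G.src e' ∈ I → G.tgt e' ∈ I →
    (G.src e = G.src e' ∨ G.src e = G.tgt e' ∨ G.tgt e = G.src e' ∨ G.tgt e = G.tgt e') →
    ∀ c : F, G.label e' ≠ c • G.label e

/-- The label of an edge as an element of the symmetric algebra `S`. -/
abbrev LabelledGraph.slabel (G : LabelledGraph.{u, v} F VF) (e : G.E) : SymmetricAlgebra F VF :=
  SymmetricAlgebra.ι F VF (G.label e)

/-- A sheaf (of `S`-modules) on a labelled graph, where `S` is the symmetric algebra of `VF`: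
modules at the vertices and at the edges, the module at an edge being annihilated by the label, and
for every edge the two restriction maps from the modules at its ends. -/
structure Sheaf (G : LabelledGraph.{u, v} F VF) where
  /-- the stalk at a vertex -/
  stalk : G.V → Type (max u v)
  [stalkAddCommGroup : ∀ x, AddCommGroup (stalk x)]
  [stalkModule : ∀ x, Module (SymmetricAlgebra F VF) (stalk x)]
  /-- the module at an edge -/
  edge : G.E → Type (max u v)
  [edgeAddCommGroup : ∀ e, AddCommGroup (edge e)]
  [edgeModule : ∀ e, Module (SymmetricAlgebra F VF) (edge e)]
  label_smul : ∀ (e : G.E) (m : edge e), G.slabel e • m = 0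
  /-- the restriction map from the start of an edge -/
  resSrc : ∀ e, stalk (G.src e) →ₗ[SymmetricAlgebra F VF] edge e
  /-- the restriction map from the end of an edge -/
  resTgt : ∀ e, stalk (G.tgt e) →ₗ[SymmetricAlgebra F VF] edge e

attribute [instance] Sheaf.stalkAddCommGroup Sheaf.stalkModule
  Sheaf.edgeAddCommGroup Sheaf.edgeModule

namespace Sheaf

variable {G : LabelledGraph.{u, v} F VF}

/-- The sections of a sheaf over a set `I` of vertices. -/
def sectionsOn (M : Sheaf G) (I : Set G.V) :
    Submodule (SymmetricAlgebra F VF) (∀ x : I, M.stalk x) where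
  carrier := {m | ∀ (e : G.E) (hs : G.src e ∈ I) (ht : G.tgt e ∈ I),
    M.resSrc e (m ⟨_, hs⟩) = M.resTgt e (m ⟨_, ht⟩)}
  add_mem' {a b} ha hb e hs ht := by simp [ha e hs ht, hb e hs ht]
  zero_mem' e hs ht := by simp
  smul_mem' c a ha e hs ht := by simp [ha e hs ht]

/-- The global sections of a sheaf. -/
def globalSections (M : Sheaf G) : Submodule (SymmetricAlgebra F VF) (∀ x, M.stalk x) where
  carrier := {m | ∀ e : G.E, M.resSrc e (m (G.src e)) = M.resTgt e (m (G.tgt e))}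
  add_mem' {a b} ha hb e := by simp [ha e, hb e]
  zero_mem' e := by simp
  smul_mem' c a ha e := by simp [ha e]

/-- The support of `M` is contained in `I`. -/
def SupportedOn (M : Sheaf G) (I : Set G.V) : Prop :=
  ∀ x, x ∉ I → ∀ a : M.stalk x, a = 0

end Sheaf

/-- The local structure algebra `𝒵(I)`: families `z` of elements of `S` indexed by `I` such that
`z x` and `z y` are congruent modulo the label of every edge joining two elements `x`, `y` of `I`. -/
def structureAlgebra (G : LabelledGraph.{u, v} F VF) (I : Set G.V) :
    Subalgebra (SymmetricAlgebra F VF) (I → SymmetricAlgebra F VF) where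
  carrier := {z | ∀ (e : G.E) (hs : G.src e ∈ I) (ht : G.tgt e ∈ I),
    z ⟨_, hs⟩ - z ⟨_, ht⟩ ∈ Ideal.span {G.slabel e}}
  mul_mem' {a b} ha hb e hs ht := by
    have : (a * b) ⟨_, hs⟩ - (a * b) ⟨_, ht⟩ =
        a ⟨_, hs⟩ * (b ⟨_, hs⟩ - b ⟨_, ht⟩) + b ⟨_, ht⟩ * (a ⟨_, hs⟩ - a ⟨_, ht⟩) := by
      simp only [Pi.mul_apply]; ring
    rw [this]
    exact add_mem (Ideal.mul_mem_left _ _ (hb e hs ht)) (Ideal.mul_mem_left _ _ (ha e hs ht))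
  add_mem' {a b} ha hb e hs ht := by
    have : (a + b) ⟨_, hs⟩ - (a + b) ⟨_, ht⟩ =
        (a ⟨_, hs⟩ - a ⟨_, ht⟩) + (b ⟨_, hs⟩ - b ⟨_, ht⟩) := by
      simp only [Pi.add_apply]; ring
    rw [this]
    exact add_mem (ha e hs ht) (hb e hs ht)
  algebraMap_mem' r e hs ht := by simp

section SectionsModule

variable {G : LabelledGraph.{u, v} F VF} {M : Sheaf G} {I : Set G.V}

open Classical in
/-- Multiplication of a global section, of a sheaf supported on `I`, by an element of `𝒵(I)`: it is
componentwise on `I`, and both sides vanish outside `I`. -/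
def zsmul (hM : M.SupportedOn I) (z : structureAlgebra G I) (m : M.globalSections) :
    M.globalSections :=
  ⟨fun x => if h : x ∈ I then z.1 ⟨x, h⟩ • m.1 x else 0, by
    intro e
    have hm := m.2 e
    by_cases hs : G.src e ∈ I
    · by_cases ht : G.tgt e ∈ I
      · simp only [hs, ht, dif_pos, map_smul]
        rw [← hm, ← sub_eq_zero, ← sub_smul]
        obtain ⟨c, hc⟩ := Ideal.mem_span_singleton'.mp (z.2 e hs ht)
        rw [← hc, mul_smul, M.label_smul, smul_zero]
      · simp only [hs, ht, dif_pos, map_smul]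
        rw [hm, hM _ ht (m.1 (G.tgt e))]
        simp
    · by_cases ht : G.tgt e ∈ I
      · simp only [hs, ht, dif_pos, map_smul]
        rw [← hm, hM _ hs (m.1 (G.src e))]
        simp
      · simp [hs, ht]⟩

theorem zsmul_of_mem (hM : M.SupportedOn I) (z : structureAlgebra G I) (m : M.globalSections)
    {x : G.V} (h : x ∈ I) : (zsmul hM z m).1 x = z.1 ⟨x, h⟩ • m.1 x := by
  simp [zsmul, h]

theorem zsmul_ext (hM : M.SupportedOn I) {m m' : M.globalSections}
    (h : ∀ x ∈ I, m.1 x = m'.1 x) : m = m' := by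
  refine Subtype.ext (funext fun x => ?_)
  by_cases hx : x ∈ I
  · exact h x hx
  · rw [hM x hx (m.1 x), hM x hx (m'.1 x)]

/-- The `𝒵(I)`-module structure on the global sections of a sheaf supported on `I`. -/
abbrev sectionsModule (hM : M.SupportedOn I) : Module (structureAlgebra G I) M.globalSections where
  smul := zsmul hM
  one_smul m := zsmul_ext hM fun x hx => (zsmul_of_mem hM _ _ hx).trans (one_smul _ _)
  mul_smul z z' m := zsmul_ext hM fun x hx => by
    change (zsmul hM _ _).1 x = (zsmul hM _ (zsmul hM _ _)).1 x
    rw [zsmul_of_mem hM _ _ hx, zsmul_of_mem hM _ _ hx, zsmul_of_mem hM _ _ hx, ← mul_smul]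
    rfl
  smul_zero z := zsmul_ext hM fun x hx => (zsmul_of_mem hM _ _ hx).trans (smul_zero _)
  smul_add z m m' := zsmul_ext hM fun x hx => by
    change (zsmul hM _ _).1 x = (zsmul hM _ _).1 x + (zsmul hM _ _).1 x
    rw [zsmul_of_mem hM _ _ hx, zsmul_of_mem hM _ _ hx, zsmul_of_mem hM _ _ hx, ← smul_add]
    rfl
  add_smul z z' m := zsmul_ext hM fun x hx => by
    change (zsmul hM _ _).1 x = (zsmul hM _ _).1 x + (zsmul hM _ _).1 x
    rw [zsmul_of_mem hM _ _ hx, zsmul_of_mem hM _ _ hx, zsmul_of_mem hM _ _ hx, ← add_smul]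
    rfl
  zero_smul m := zsmul_ext hM fun x hx => (zsmul_of_mem hM _ _ hx).trans (zero_smul _ _)

end SectionsModule

end Graphs

/-! ### The affine Weyl group and affine roots -/

section AffineWeyl

variable {ι V N : Type v} [AddCommGroup V] [Module ℚ V] [AddCommGroup N] [Module ℚ N]

/-- The weight lattice `X`: the vectors taking integral values on all coroots. -/
def weightLattice (P : RootPairing ι ℚ V N) : AddSubgroup V where
  carrier := {x | ∀ i, ∃ n : ℤ, P.toLinearMap x (P.coroot i) = n}
  add_mem' {x y} hx hy i := by
    obtain ⟨a, ha⟩ := hx i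
    obtain ⟨c, hc⟩ := hy i
    exact ⟨a + c, by simp [ha, hc]⟩
  zero_mem' i := ⟨0, by simp⟩
  neg_mem' {x} hx i := by
    obtain ⟨a, ha⟩ := hx i
    exact ⟨-a, by simp [ha]⟩

/-- The lattice of affine weights `X̂ = X ⊕ ℤ`. -/
abbrev AffineWeight (P : RootPairing ι ℚ V N) : Type v := weightLattice P × ℤ

/-- The affine root `(α, n)` is represented by the pair of the index of `α` and `n`. -/
abbrev AffineRoot (_P : RootPairing ι ℚ V N) : Type v := ι × ℤ

/-- The affine reflection `s_{α,n} : v ↦ v - (⟨α, v⟩ - n) α^∨`, where `α` is the root with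
index `i`. -/
def affineReflection (P : RootPairing ι ℚ V N) (i : ι) (n : ℤ) : N ≃ᵃ[ℚ] N where
  toFun v := v - (P.toLinearMap (P.root i) v - n) • P.coroot i
  invFun v := v - (P.toLinearMap (P.root i) v - n) • P.coroot i
  left_inv v := by
    have h : P.toLinearMap (P.root i) (P.coroot i) = 2 := P.root_coroot_two i
    simp only [map_sub, map_smul, h, smul_eq_mul]
    module
  right_inv v := by
    have h : P.toLinearMap (P.root i) (P.coroot i) = 2 := P.root_coroot_two i
    simp only [map_sub, map_smul, h, smul_eq_mul]
    module
  linear := P.coreflection i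
  map_vadd' p v := by
    change v + p - (P.toLinearMap (P.root i) (v + p) - n) • P.coroot i =
      P.coreflection i v + (p - (P.toLinearMap (P.root i) p - n) • P.coroot i)
    rw [P.coreflection_apply, map_add]
    change _ = v - P.toLinearMap (P.root i) v • P.coroot i + _
    module

/-- The affine Weyl group: the group of affine transformations generated by all the affine
reflections. -/
def affineWeylGroup (P : RootPairing ι ℚ V N) : Subgroup (N ≃ᵃ[ℚ] N) :=
  Subgroup.closure (Set.range fun p : ι × ℤ => affineReflection P p.1 p.2)

/-- The reflection `s_γ` attached to an affine root: `s_{(α,n)} = s_{α,-n}`. -/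
def rootReflection (P : RootPairing ι ℚ V N) (γ : AffineRoot P) : affineWeylGroup P :=
  ⟨affineReflection P γ.1 (-γ.2), Subgroup.subset_closure ⟨(γ.1, -γ.2), rfl⟩⟩

/-- The pairing of `V ⊕ ℚ` with the points of `V^*` (the points of level one of `V^* ⊕ ℚ`):
`⟨(x, m), (v, 1)⟩ = ⟨x, v⟩ + m`. -/
def levelOnePairing (P : RootPairing ι ℚ V N) (β : V × ℚ) (v : N) : ℚ :=
  P.toLinearMap β.1 v + β.2

/-- The action on `V ⊕ ℚ` dual to the action of affine transformations on points, characterized by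
`⟨w β, v⟩ = ⟨β, w⁻¹ v⟩`. -/
def dualAct (P : RootPairing ι ℚ V N) (w : N ≃ᵃ[ℚ] N) (β : V × ℚ) : V × ℚ :=
  (P.toPerfPair.symm (P.toPerfPair β.1 ∘ₗ ((w⁻¹ : N ≃ᵃ[ℚ] N).linear : N →ₗ[ℚ] N)),
    levelOnePairing P β ((w⁻¹ : N ≃ᵃ[ℚ] N) 0))

theorem levelOnePairing_dualAct (P : RootPairing ι ℚ V N) (w : N ≃ᵃ[ℚ] N) (β : V × ℚ) (v : N) :
    levelOnePairing P (dualAct P w β) v = levelOnePairing P β ((w⁻¹ : N ≃ᵃ[ℚ] N) v) := by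
  have h : (w⁻¹ : N ≃ᵃ[ℚ] N) v = (w⁻¹ : N ≃ᵃ[ℚ] N).linear v + (w⁻¹ : N ≃ᵃ[ℚ] N) 0 := by
    have := (w⁻¹ : N ≃ᵃ[ℚ] N).map_vadd 0 v
    rwa [vadd_eq_add, add_zero, vadd_eq_add] at this
  have h2 : ∀ f : Module.Dual ℚ N, P.toLinearMap (P.toPerfPair.symm f) v = f v := by
    intro f
    have := LinearMap.congr_fun (P.toPerfPair.apply_symm_apply f) v
    simpa using! this
  rw [h]
  simp only [levelOnePairing, dualAct, h2, map_add]
  simp [add_assoc]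

theorem levelOnePairing_injective (P : RootPairing ι ℚ V N) {β β' : V × ℚ}
    (h : ∀ v, levelOnePairing P β v = levelOnePairing P β' v) : β = β' := by
  have h0 : β.2 = β'.2 := by simpa [levelOnePairing] using h 0
  refine Prod.ext (P.toPerfPair.injective (LinearMap.ext fun v => ?_)) h0
  have := h v
  simp only [levelOnePairing, h0, add_left_inj] at this
  simpa using! this

theorem dualAct_mul (P : RootPairing ι ℚ V N) (w w' : N ≃ᵃ[ℚ] N) (β : V × ℚ) :
    dualAct P (w * w') β = dualAct P w (dualAct P w' β) := by
  refine levelOnePairing_injective P fun v => ?_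
  simp only [levelOnePairing_dualAct, mul_inv_rev, AffineEquiv.coe_mul, Function.comp_apply]

theorem dualAct_one (P : RootPairing ι ℚ V N) (β : V × ℚ) : dualAct P 1 β = β := by
  refine levelOnePairing_injective P fun v => ?_
  simp [levelOnePairing_dualAct]

/-- The inclusion of the lattice of affine weights into `V ⊕ ℚ`. -/
def affineWeightCoe (P : RootPairing ι ℚ V N) (β : AffineWeight P) : V × ℚ := (β.1, β.2)

theorem affineWeightCoe_injective (P : RootPairing ι ℚ V N) :
    Function.Injective (affineWeightCoe P) := by
  rintro ⟨⟨x, hx⟩, m⟩ ⟨⟨y, hy⟩, n⟩ h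
  simpa [affineWeightCoe] using h

theorem affineReflection_inv (P : RootPairing ι ℚ V N) (i : ι) (n : ℤ) :
    (affineReflection P i n)⁻¹ = affineReflection P i n :=
  AffineEquiv.ext fun _ => rfl

theorem dualAct_affineReflection (P : RootPairing ι ℚ V N) (i : ι) (n : ℤ) (β : V × ℚ) :
    dualAct P (affineReflection P i n) β =
      β - P.toLinearMap β.1 (P.coroot i) • (P.root i, -(n : ℚ)) := by
  refine levelOnePairing_injective P fun v => ?_
  rw [levelOnePairing_dualAct, affineReflection_inv]
  change P.toLinearMap β.1 (v - (P.toLinearMap (P.root i) v - n) • P.coroot i) + β.2 =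
    P.toLinearMap (β.1 - P.toLinearMap β.1 (P.coroot i) • P.root i) v +
      (β.2 - P.toLinearMap β.1 (P.coroot i) * -(n : ℚ))
  simp only [map_sub, map_smul, LinearMap.sub_apply, LinearMap.smul_apply, smul_eq_mul]
  ring

variable (P : RootPairing ι ℚ V N) [P.IsCrystallographic]

theorem root_mem_weightLattice (i : ι) : P.root i ∈ weightLattice P :=
  fun j => ⟨P.pairingIn ℤ i j, by
    rw [P.root_coroot_eq_pairing, ← P.algebraMap_pairingIn ℤ, eq_intCast]⟩

/-- An affine root, viewed as an affine weight. -/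
def AffineRoot.toWeight (γ : AffineRoot P) : AffineWeight P :=
  (⟨P.root γ.1, root_mem_weightLattice P γ.1⟩, γ.2)

theorem dualAct_mem (w : affineWeylGroup P) (β : AffineWeight P) :
    ∃ β' : AffineWeight P, affineWeightCoe P β' = dualAct P w.1 (affineWeightCoe P β) := by
  obtain ⟨w, hw⟩ := w
  induction hw using Subgroup.closure_induction_left generalizing β with
  | one => exact ⟨β, (dualAct_one P _).symm⟩
  | mul_left x hx y hy ih =>
    obtain ⟨⟨i, n⟩, rfl⟩ := hx
    obtain ⟨β₁, h₁⟩ := ih β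
    obtain ⟨c, hc⟩ := β₁.1.2 i
    refine ⟨β₁ - c • AffineRoot.toWeight P (i, -n), ?_⟩
    simp only at h₁ ⊢
    rw [dualAct_mul, ← h₁, dualAct_affineReflection]
    simp only [affineWeightCoe, hc]
    ext <;> simp [AffineRoot.toWeight, ← Int.cast_smul_eq_zsmul ℚ]
  | inv_mul_cancel x hx y hy ih =>
    obtain ⟨⟨i, n⟩, rfl⟩ := hx
    obtain ⟨β₁, h₁⟩ := ih β
    obtain ⟨c, hc⟩ := β₁.1.2 i
    refine ⟨β₁ - c • AffineRoot.toWeight P (i, -n), ?_⟩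
    simp only at h₁ ⊢
    rw [affineReflection_inv, dualAct_mul, ← h₁, dualAct_affineReflection]
    simp only [affineWeightCoe, hc]
    ext <;> simp [AffineRoot.toWeight, ← Int.cast_smul_eq_zsmul ℚ]

/-- The action of the affine Weyl group on affine weights (the restriction of the dual action). -/
def weightAct (w : affineWeylGroup P) (β : AffineWeight P) : AffineWeight P :=
  (dualAct_mem P w β).choose

theorem affineWeightCoe_weightAct (w : affineWeylGroup P) (β : AffineWeight P) :
    affineWeightCoe P (weightAct P w β) = dualAct P w.1 (affineWeightCoe P β) :=
  (dualAct_mem P w β).choose_spec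

variable {P} [Finite ι] [P.IsRootSystem] [P.IsReduced] [P.IsIrreducible] (b : P.Base)

/-- Existence of the highest root. -/
theorem exists_highestRoot :
    ∃ θ : ι, ∀ j : ι, P.root θ - P.root j ∈ AddSubmonoid.closure (P.root '' b.support) := by
  classical
  have : Nontrivial V := RootPairing.IsIrreducible.nontrivial P
  have hne : Nonempty ι := by
    by_contra h
    rw [not_nonempty_iff] at h
    have h1 := RootPairing.IsRootSystem.span_root_eq_top (P := P)
    rw [Set.range_eq_empty, Submodule.span_empty] at h1
    exact bot_ne_top h1
  have hpos (i : ι) (hi : b.IsPos i) : ∃ f : ι → ℤ, (∀ j, 0 ≤ f j) ∧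
      P.root i = ∑ j ∈ b.support, f j • P.root j := by
    obtain ⟨f, hf₀, hf₁, hf₂⟩ := b.exists_root_eq_sum_int i
    refine ⟨f, ?_, hf₂⟩
    refine (hf₁.resolve_right ?_).le
    intro h
    rw [b.isPos_iff, RootPairing.Base.height_eq_sum hf₂] at hi
    exact absurd hi (not_lt.mpr (Finset.sum_nonpos fun i _ ↦ h.le i))
  have hcl (i : ι) (hi : b.IsPos i) :
      P.root i ∈ AddSubmonoid.closure (P.root '' b.support) := by
    obtain ⟨f, hf, h⟩ := hpos i hi
    rw [h]
    refine sum_mem fun j hj => ?_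
    obtain ⟨n, hn⟩ := Int.eq_ofNat_of_zero_le (hf j)
    rw [hn, natCast_zsmul]
    exact nsmul_mem (AddSubmonoid.subset_closure (Set.mem_image_of_mem _ hj)) n
  have hpair (i j : ι) (f : ι → ℤ) (hf : P.root i = ∑ k ∈ b.support, f k • P.root k) :
      P.pairingIn ℤ i j = ∑ k ∈ b.support, f k * P.pairingIn ℤ k j := by
    apply FaithfulSMul.algebraMap_injective ℤ ℚ
    simp_rw [P.algebraMap_pairingIn, map_sum, ← P.root_coroot_eq_pairing, hf, map_sum, map_zsmul,
        LinearMap.coe_sum, Finset.sum_apply, LinearMap.smul_apply, P.root_coroot_eq_pairing,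
        map_mul, zsmul_eq_mul, P.algebraMap_pairingIn, eq_intCast]
  have hstep (i k : ι) (hi : b.IsPos i) (hk : k ∈ b.support) (h : P.pairingIn ℤ i k < 0) :
      ∃ m, P.root m = P.root i + P.root k := by
    refine P.root_add_root_mem_of_pairingIn_neg h fun h' => ?_
    have : b.height i + b.height k = 0 := by
      let _i := P.indexNeg
      have := b.height_reflectionPerm_self k
      have h2 : i = -k := P.root.injective (by simpa using h')
      rw [h2, this]; simp
    rw [b.isPos_iff] at hi
    rw [RootPairing.Base.height_one_of_mem_support hk] at this
    omega
  obtain ⟨θ, hθ⟩ := Finite.exists_max (fun i => b.height i)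
  obtain ⟨s, hs⟩ := b.support_nonempty
  have hθpos : b.IsPos θ := by
    rw [b.isPos_iff]
    have := hθ s
    rw [RootPairing.Base.height_one_of_mem_support hs] at this
    omega
  obtain ⟨f, hf, hfθ⟩ := hpos θ hθpos
  have hdom : ∀ k ∈ b.support, 0 ≤ P.pairingIn ℤ θ k := by
    intro k hk
    by_contra! h
    obtain ⟨m, hm⟩ := hstep θ k hθpos hk h
    have h1 := b.height_add hm
    have := hθ m
    rw [RootPairing.Base.height_one_of_mem_support hk] at h1
    omega
  have hf0 : ∀ k : b.support, f k ≠ 0 := by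
    obtain ⟨k₀, hk₀, hfk₀⟩ : ∃ k ∈ b.support, f k ≠ 0 := by
      by_contra! h
      exact P.ne_zero θ (by rw [hfθ]; exact Finset.sum_eq_zero fun k hk => by simp [h k hk])
    intro k
    refine b.induction_on_cartanMatrix (fun k => f k ≠ 0) (i := ⟨k₀, hk₀⟩) hfk₀ ?_
    intro i j hi hij hj
    have hij' : i ≠ j := by rintro rfl; exact hi hj
    have h1 : P.pairingIn ℤ (i : ι) j < 0 := by
      refine lt_of_le_of_ne (b.pairingIn_le_zero_of_ne (fun h => hij' (Subtype.ext h)) i.2 j.2) ?_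
      intro h
      exact hij (P.pairingIn_eq_zero_iff.mp h)
    have h2 := hdom j j.2
    rw [hpair θ j f hfθ] at h2
    refine absurd h2 (not_le.mpr ?_)
    refine Finset.sum_neg' (fun k hk => ?_) ⟨i, i.2, ?_⟩
    · by_cases hkj : k = j
      · simp [hkj, hj]
      · exact mul_nonpos_of_nonneg_of_nonpos (hf k) (b.pairingIn_le_zero_of_ne hkj hk j.2)
    · exact mul_neg_of_pos_of_neg (lt_of_le_of_ne (hf i) (Ne.symm hi)) h1
  have key : ∀ j, b.IsPos j → P.root θ - P.root j ∈ AddSubmonoid.closure (P.root '' b.support) := by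
    intro j hj
    have : Nonempty {k : ι // P.root k - P.root j ∈ AddSubmonoid.closure (P.root '' b.support)} :=
      ⟨⟨j, by rw [sub_self]; exact zero_mem _⟩⟩
    obtain ⟨⟨m, hmj⟩, hm⟩ := Finite.exists_max
      (fun k : {k : ι // P.root k - P.root j ∈ AddSubmonoid.closure (P.root '' b.support)} =>
        b.height k)
    have hmpos : b.IsPos m := by
      rw [b.isPos_iff] at hj ⊢
      exact hj.trans_le (hm ⟨j, by rw [sub_self]; exact zero_mem _⟩)
    have hmdom : ∀ k ∈ b.support, 0 ≤ P.pairingIn ℤ m k := by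
      intro k hk
      by_contra! h
      obtain ⟨r, hr⟩ := hstep m k hmpos hk h
      have h1 := b.height_add hr
      have : b.height r ≤ b.height m := hm ⟨r, by
        rw [hr, add_sub_right_comm]
        exact add_mem hmj (AddSubmonoid.subset_closure (Set.mem_image_of_mem _ hk))⟩
      rw [RootPairing.Base.height_one_of_mem_support hk] at h1
      omega
    by_cases hmθ : m = θ
    · rw [← hmθ]; exact hmj
    have hlt : 0 < P.pairingIn ℤ θ m := by
      rw [hpair θ m f hfθ]
      obtain ⟨k, hk, hk'⟩ := hmpos.exists_mem_support_pos_pairingIn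
      refine Finset.sum_pos' (fun k hk => mul_nonneg (hf k) ?_) ⟨k, hk, mul_pos
        (lt_of_le_of_ne (hf k) (Ne.symm (hf0 ⟨k, hk⟩))) hk'⟩
      have := hmdom k hk
      by_contra! h
      rw [P.pairingIn_lt_zero_iff] at h
      omega
    obtain ⟨r, hr⟩ := P.root_sub_root_mem_of_pairingIn_pos hlt (Ne.symm hmθ)
    have h1 := b.height_sub hr
    have h2 := b.height_ne_zero r
    have h3 := hθ m
    have := add_mem (hcl r (by rw [b.isPos_iff]; omega)) hmj
    rwa [hr, sub_add_sub_cancel] at this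
  refine ⟨θ, fun j => ?_⟩
  let _i := P.indexNeg
  rcases RootPairing.Base.IsPos.or_neg b j with hj | hj
  · exact key j hj
  · have := add_mem (hcl θ hθpos) (hcl _ hj)
    simpa [sub_eq_add_neg] using this

/-- The index of the highest root `α̃`: the root such that all `α̃ - α`, with `α` a root, are sums of
simple roots. -/
def highestRoot : ι := (exists_highestRoot b).choose

/-- The simple affine roots: `(α, 0)` for simple `α` (the indices `some α`), and `(-α̃, 1)`
(the index `none`). -/
abbrev SimpleAffineRoot (_b : P.Base) : Type v := Option _b.support

/-- The simple affine root with a given index. -/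
def SimpleAffineRoot.toRoot : SimpleAffineRoot b → AffineRoot P
  | some i => (i.1, 0)
  | none => (P.reflectionPerm (highestRoot b) (highestRoot b), 1)

/-- The simple reflection attached to a simple affine root. -/
def simpleReflection (a : SimpleAffineRoot b) : affineWeylGroup P :=
  rootReflection P (SimpleAffineRoot.toRoot b a)

/-- The affine root `(α, n)` is positive if `n > 0`, or if `n = 0` and `α` is positive. -/
def AffineRoot.IsPositive (b : P.Base) (γ : AffineRoot P) : Prop :=
  0 < γ.2 ∨ (γ.2 = 0 ∧ b.IsPos γ.1)

/-- The length of `w`: the smallest number of factors in an expression of `w` as a product of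
simple reflections. -/
def length (w : affineWeylGroup P) : ℕ :=
  sInf {n | ∃ L : List (SimpleAffineRoot b), L.length = n ∧ (L.map (simpleReflection b)).prod = w}

/-- The reflections of the Coxeter group: the conjugates of the simple reflections. -/
def IsReflection (t : affineWeylGroup P) : Prop :=
  ∃ (a : SimpleAffineRoot b) (w : affineWeylGroup P), t = w * simpleReflection b a * w⁻¹

/-- The relation generating the Bruhat order: `y = x t` with `t` a reflection, and
`ℓ(x) < ℓ(y)`. -/
def BruhatStep (x y : affineWeylGroup P) : Prop :=
  length b x < length b y ∧ ∃ t, IsReflection b t ∧ y = x * t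

theorem length_le_of_bruhat {x y : affineWeylGroup P}
    (h : Relation.ReflTransGen (BruhatStep b) x y) : x = y ∨ length b x < length b y := by
  induction h with
  | refl => exact Or.inl rfl
  | tail _ h ih =>
    rcases ih with rfl | ih
    · exact Or.inr h.1
    · exact Or.inr (ih.trans h.1)

/-- The Bruhat order on the affine Weyl group. -/
abbrev bruhatOrder : PartialOrder (affineWeylGroup P) where
  le := Relation.ReflTransGen (BruhatStep b)
  le_refl _ := Relation.ReflTransGen.refl
  le_trans _ _ _ := Relation.ReflTransGen.trans
  le_antisymm x y h h' := by
    rcases length_le_of_bruhat b h with h | h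
    · exact h
    · rcases length_le_of_bruhat b h' with h' | h'
      · exact h'.symm
      · exact absurd h (not_lt.mpr h'.le)

end AffineWeyl

/-! ### The moment graphs -/

section AffineGraphs

variable (F : Type u) [Field F]
variable {ι V N : Type v} [AddCommGroup V] [Module ℚ V] [AddCommGroup N] [Module ℚ N]

/-- The space `X̂ ⊗ F` in which the labels live. -/
abbrev LabelSpace (P : RootPairing ι ℚ V N) : Type (max u v) := F ⊗[ℤ] AffineWeight P

/-- The symmetric algebra `S` of `X̂ ⊗ F`. -/
abbrev SymAlg (P : RootPairing ι ℚ V N) : Type (max u v) := SymmetricAlgebra F (LabelSpace F P)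

variable {P : RootPairing ι ℚ V N}

/-- The reduction of an affine weight to the field `F`. -/
def reduceWeight (β : AffineWeight P) : LabelSpace F P := (1 : F) ⊗ₜ[ℤ] β

variable [P.IsCrystallographic]

theorem reduceWeight_root_ne_zero [NeZero (2 : F)] (γ : AffineRoot P) :
    reduceWeight F (AffineRoot.toWeight P γ) ≠ 0 := by
  intro h
  let f : AffineWeight P →+ ℤ :=
    { toFun := fun β => (β.1.2 γ.1).choose
      map_zero' := by
        have := ((0 : AffineWeight P).1.2 γ.1).choose_spec
        have h2 : P.toLinearMap ((0 : AffineWeight P).1 : V) (P.coroot γ.1) = 0 := by simp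
        exact_mod_cast (h2.symm.trans this).symm
      map_add' := fun x y => by
        have h1 := ((x + y).1.2 γ.1).choose_spec
        have h2 := (x.1.2 γ.1).choose_spec
        have h3 := (y.1.2 γ.1).choose_spec
        have h4 : P.toLinearMap ((x + y).1 : V) (P.coroot γ.1) =
            P.toLinearMap (x.1 : V) (P.coroot γ.1) + P.toLinearMap (y.1 : V) (P.coroot γ.1) := by
          simp
        exact_mod_cast h1.symm.trans (h4.trans (congrArg₂ (· + ·) h2 h3)) }
  have hf : f (AffineRoot.toWeight P γ) = 2 := by
    have h1 := ((AffineRoot.toWeight P γ).1.2 γ.1).choose_spec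
    have h2 : P.toLinearMap ((AffineRoot.toWeight P γ).1 : V) (P.coroot γ.1) = 2 :=
      P.root_coroot_two γ.1
    exact_mod_cast (h2.symm.trans h1).symm
  have := congrArg (LinearMap.lTensor F f.toIntLinearMap) h
  rw [reduceWeight, LinearMap.lTensor_tmul, map_zero] at this
  have h3 := congrArg (TensorProduct.rid ℤ F) this
  rw [TensorProduct.rid_tmul, map_zero] at h3
  change f (AffineRoot.toWeight P γ) • (1 : F) = 0 at h3
  rw [hf] at h3
  exact NeZero.ne (2 : F) (by simpa using h3)

variable [Finite ι] [P.IsRootSystem] [P.IsReduced] [P.IsIrreducible] (b : P.Base)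

/-- An edge of the affine moment graph: a vertex `x` and a positive affine root `γ` with
`x < s_γ x` in the Bruhat order. -/
structure AffineEdge where
  /-- the start of the edge -/
  source : affineWeylGroup P
  /-- the root of the edge -/
  root : AffineRoot P
  isPositive : AffineRoot.IsPositive b root
  lt : (bruhatOrder b).lt source (rootReflection P root * source)

/-- The end of an edge of the affine moment graph. -/
def AffineEdge.target (e : AffineEdge b) : affineWeylGroup P := rootReflection P e.root * e.source

variable [NeZero (2 : F)]

/-- The moment graph of the affine Weyl group. -/
abbrev affineMomentGraph : MomentGraph.{u, v} F (LabelSpace F P) where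
  V := affineWeylGroup P
  E := AffineEdge b
  src := AffineEdge.source
  tgt := AffineEdge.target b
  label e := reduceWeight F (AffineRoot.toWeight P e.root)
  label_ne_zero e := reduceWeight_root_ne_zero F e.root
  order := bruhatOrder b
  src_lt_tgt e := e.lt

/-- The labelled graph underlying the moment graph of the affine Weyl group. -/
abbrev affineGraph : LabelledGraph.{u, v} F (LabelSpace F P) :=
  (affineMomentGraph F b).toLabelledGraph

/-- An edge of the quotient by a subgroup `H`: two distinct cosets and a positive affine root `γ`
such that there are representatives joined by an edge of the affine moment graph with root `γ`. -/
structure QuotientEdge (H : Subgroup (affineWeylGroup P)) where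
  /-- the start of the edge -/
  source : affineWeylGroup P ⧸ H
  /-- the end of the edge -/
  target : affineWeylGroup P ⧸ H
  /-- the root of the edge -/
  root : AffineRoot P
  ne : source ≠ target
  exists_rep : ∃ e : AffineEdge b, (e.source : affineWeylGroup P ⧸ H) = source ∧
    (e.target : affineWeylGroup P ⧸ H) = target ∧ e.root = root

/-- The labelled graph on the left cosets of a subgroup `H`, the quotient of the affine moment
graph (without the induced order on the cosets, which sheaves do not see). -/
abbrev quotientGraph (H : Subgroup (affineWeylGroup P)) :
    LabelledGraph.{u, v} F (LabelSpace F P) where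
  V := affineWeylGroup P ⧸ H
  E := QuotientEdge b H
  src := QuotientEdge.source
  tgt := QuotientEdge.target
  label e := reduceWeight F (AffineRoot.toWeight P e.root)
  label_ne_zero e := reduceWeight_root_ne_zero F e.root

/-! ### Translation functors -/

variable {F b}
variable {H : Subgroup (affineWeylGroup P)}

/-- The edges of the affine moment graph lying over an edge of the quotient graph. -/
def EdgesOver (e : QuotientEdge b H) : Type v :=
  {e' : AffineEdge b // (e'.source : affineWeylGroup P ⧸ H) = e.source ∧
    (e'.target : affineWeylGroup P ⧸ H) = e.target ∧ e'.root = e.root}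

/-- The fibre of the projection to the cosets of `H`. -/
def cosetFibre (H : Subgroup (affineWeylGroup P)) (c : affineWeylGroup P ⧸ H) :
    Set (affineWeylGroup P) := {x | (x : affineWeylGroup P ⧸ H) = c}

/-- The stalks of the sheaf `ϑ_on M`: sections of `M` over the fibres of the projection. -/
abbrev OnStalk (M : Sheaf (affineGraph F b)) (c : affineWeylGroup P ⧸ H) : Type (max u v) :=
  M.sectionsOn (cosetFibre H c)

/-- Restriction of a section over the fibre of the start of an edge `e` to all the edges
over `e`. -/
def onSrc (M : Sheaf (affineGraph F b)) (e : QuotientEdge b H) :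
    OnStalk M e.source →ₗ[SymAlg F P] (∀ e' : EdgesOver e, M.edge e'.1) :=
  LinearMap.pi fun e' => M.resSrc e'.1 ∘ₗ
    LinearMap.proj (⟨e'.1.source, e'.2.1⟩ : cosetFibre H e.source) ∘ₗ Submodule.subtype _

/-- Restriction of a section over the fibre of the end of an edge `e` to all the edges
over `e`. -/
def onTgt (M : Sheaf (affineGraph F b)) (e : QuotientEdge b H) :
    OnStalk M e.target →ₗ[SymAlg F P] (∀ e' : EdgesOver e, M.edge e'.1) :=
  LinearMap.pi fun e' => M.resTgt e'.1 ∘ₗ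
    LinearMap.proj (⟨e'.1.target, e'.2.2.1⟩ : cosetFibre H e.target) ∘ₗ Submodule.subtype _

open Classical in
/-- Translation onto the wall. The stalk at a coset is the module of sections of `M` over the coset.
The module at an edge is the image of the stalk at the end of the edge in the product of the modules
at the edges lying over it. The restriction map from the start of the edge is given by the
restriction maps of `M`; it is defined as soon as it takes values in that image (which is the case
when `M` is a projective sheaf), and is set to `0` otherwise. -/
def thetaOn (H : Subgroup (affineWeylGroup P)) (M : Sheaf (affineGraph F b)) :
    Sheaf (quotientGraph F b H) where
  stalk c := OnStalk M c
  edge e := LinearMap.range (onTgt M e)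
  label_smul e := by
    rintro ⟨m, hm⟩
    refine Subtype.ext (funext fun e' => ?_)
    have h := M.label_smul e'.1 (m e')
    simp only [LabelledGraph.slabel, e'.2.2.2] at h
    exact h
  resSrc e := if h : LinearMap.range (onSrc M e) ≤ LinearMap.range (onTgt M e) then
      (onSrc M e).codRestrict _ fun m => h (LinearMap.mem_range_self _ m) else 0
  resTgt e := (onTgt M e).rangeRestrict

/-- An edge module together with the two restriction maps. -/
structure EdgeDatum (S : Type w) [CommRing S] (A B : Type w) [AddCommGroup A]
    [AddCommGroup B] [Module S A] [Module S B] (a : S) where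
  /-- the module -/
  carrier : Type w
  [addCommGroup : AddCommGroup carrier]
  [module : Module S carrier]
  smul_eq_zero : ∀ m : carrier, a • m = 0
  /-- the map from the start -/
  fromSrc : A →ₗ[S] carrier
  /-- the map from the end -/
  fromTgt : B →ₗ[S] carrier

attribute [instance] EdgeDatum.addCommGroup EdgeDatum.module

/-- The identification of the stalks at equal vertices. -/
def stalkCast {G : LabelledGraph.{u, v} F (LabelSpace F P)} (M : Sheaf G) {x y : G.V} (h : x = y) :
    M.stalk x →ₗ[SymAlg F P] M.stalk y := h ▸ LinearMap.id

/-- The edge datum of `ϑ_out M` at an edge joining two elements of one coset: the quotient of the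
stalk of `M` at the coset by the label. -/
def outInner (M : Sheaf (quotientGraph F b H)) (e : AffineEdge b)
    (h : (e.source : affineWeylGroup P ⧸ H) = (e.target : affineWeylGroup P ⧸ H)) :
    EdgeDatum (SymAlg F P) (M.stalk e.source) (M.stalk e.target) ((affineGraph F b).slabel e) where
  carrier := M.stalk e.source ⧸
    (Ideal.span {(affineGraph F b).slabel e} • ⊤ : Submodule (SymAlg F P) (M.stalk e.source))
  smul_eq_zero m := by
    obtain ⟨m, rfl⟩ := Submodule.mkQ_surjective _ m
    rw [← map_smul, Submodule.mkQ_apply, Submodule.Quotient.mk_eq_zero]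
    exact Submodule.smul_mem_smul (Ideal.mem_span_singleton_self _) trivial
  fromSrc := Submodule.mkQ _
  fromTgt := Submodule.mkQ _ ∘ₗ stalkCast M h.symm

/-- The edge of the quotient graph under an edge joining elements of different cosets. -/
def quotientEdgeOf (e : AffineEdge b)
    (h : (e.source : affineWeylGroup P ⧸ H) ≠ (e.target : affineWeylGroup P ⧸ H)) :
    QuotientEdge b H where
  source := e.source
  target := e.target
  root := e.root
  ne := h
  exists_rep := ⟨e, rfl, rfl, rfl⟩

/-- The edge datum of `ϑ_out M` at an edge joining elements of different cosets: that of `M` at the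
image of the edge in the quotient graph. -/
def outOuter (M : Sheaf (quotientGraph F b H)) (e : AffineEdge b)
    (h : (e.source : affineWeylGroup P ⧸ H) ≠ (e.target : affineWeylGroup P ⧸ H)) :
    EdgeDatum (SymAlg F P) (M.stalk e.source) (M.stalk e.target) ((affineGraph F b).slabel e) where
  carrier := M.edge (quotientEdgeOf e h)
  smul_eq_zero := M.label_smul (quotientEdgeOf e h)
  fromSrc := M.resSrc (quotientEdgeOf e h)
  fromTgt := M.resTgt (quotientEdgeOf e h)

open Classical in
/-- The edge datum of `ϑ_out M` at an arbitrary edge. -/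
def outDatum (M : Sheaf (quotientGraph F b H)) (e : AffineEdge b) :
    EdgeDatum (SymAlg F P) (M.stalk e.source) (M.stalk e.target) ((affineGraph F b).slabel e) :=
  if h : (e.source : affineWeylGroup P ⧸ H) = (e.target : affineWeylGroup P ⧸ H) then
    outInner M e h else outOuter M e h

/-- Translation out of the wall. The stalk at `x` is the stalk of `M` at the coset of `x`. -/
def thetaOut (M : Sheaf (quotientGraph F b H)) : Sheaf (affineGraph F b) where
  stalk x := M.stalk (x : affineWeylGroup P ⧸ H)
  edge e := (outDatum M e).carrier
  label_smul e := (outDatum M e).smul_eq_zero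
  resSrc e := (outDatum M e).fromSrc
  resTgt e := (outDatum M e).fromTgt

/-- The translation functor `ϑ^s = ϑ^s_out ∘ ϑ^s_on` for the simple reflection `s` attached to a
simple affine root, defined through the subgroup `{1, s}`. -/
def theta (a : SimpleAffineRoot b) (M : Sheaf (affineGraph F b)) : Sheaf (affineGraph F b) :=
  thetaOut (thetaOn (Subgroup.closure {simpleReflection b a}) M)

variable (F b)

open Classical in
/-- The Braden-MacPherson sheaf `B(e)`: the stalk at the neutral element is `S`, all the other stalks
and all the modules at edges are zero. -/
def skyscraper : Sheaf (affineGraph F b) where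
  stalk x := ↥(if x = (1 : affineWeylGroup P) then ⊤ else ⊥ : Submodule (SymAlg F P) (SymAlg F P))
  edge _ := PUnit
  label_smul _ _ := rfl
  resSrc _ := 0
  resTgt _ := 0

/-! ### Bott-Samelson sheaves and the modules `X(s)` -/

/-- The Bott-Samelson sheaf of a sequence of simple reflections (given by their simple affine
roots). -/
def bottSamelson : ∀ {l : ℕ}, (Fin l → SimpleAffineRoot b) → Sheaf (affineGraph F b)
  | 0, _ => skyscraper F b
  | l + 1, s => theta (s (Fin.last l)) (bottSamelson (l := l) (Fin.init s))

variable {F b}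

/-- A subsequence of a sequence of length `l`: the entries where `σ` is `false` are replaced with
blanks. -/
abbrev Subseq (l : ℕ) : Type := Fin l → Bool

/-- The product of the entries of a subsequence, ignoring blanks. -/
def ev {l : ℕ} (s : Fin l → SimpleAffineRoot b) (σ : Subseq l) : affineWeylGroup P :=
  (List.ofFn fun i => if σ i then simpleReflection b (s i) else 1).prod

/-- The set `J(s)` of all the products of subsequences of `s`. -/
def J {l : ℕ} (s : Fin l → SimpleAffineRoot b) : Set (affineWeylGroup P) := Set.range (ev s)

theorem ev_mem_J {l : ℕ} (s : Fin l → SimpleAffineRoot b) (σ : Subseq l) : ev s σ ∈ J s := ⟨σ, rfl⟩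

theorem ev_succ {l : ℕ} (s : Fin (l + 1) → SimpleAffineRoot b) (σ : Subseq (l + 1)) :
    ev s σ = ev (Fin.init s) (Fin.init σ) *
      if σ (Fin.last l) then simpleReflection b (s (Fin.last l)) else 1 := by
  rw [ev, List.ofFn_succ_last, List.prod_append, List.prod_singleton]
  rfl

theorem simpleReflection_mul_self (a : SimpleAffineRoot b) :
    simpleReflection b a * simpleReflection b a = 1 :=
  Subtype.ext (AffineEquiv.ext fun v =>
    (affineReflection P (SimpleAffineRoot.toRoot b a).1 (-(SimpleAffineRoot.toRoot b a).2)).left_inv v)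

theorem J_mul_mem {l : ℕ} (s : Fin (l + 1) → SimpleAffineRoot b) {x y : affineWeylGroup P}
    (hx : x ∈ J (Fin.init s))
    (hxy : (x : affineWeylGroup P ⧸ Subgroup.closure {simpleReflection b (s (Fin.last l))}) = y) :
    y ∈ J s := by
  have key : ∀ t ∈ Subgroup.closure {simpleReflection b (s (Fin.last l))},
      t = 1 ∨ t = simpleReflection b (s (Fin.last l)) := by
    intro t ht
    induction ht using Subgroup.closure_induction with
    | mem t ht => exact Or.inr ht
    | one => exact Or.inl rfl
    | mul t t' _ _ h h' =>
      rcases h with rfl | rfl <;> rcases h' with rfl | rfl <;> simp [simpleReflection_mul_self]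
    | inv t _ h =>
      rcases h with rfl | rfl
      · simp
      · exact Or.inr (inv_eq_of_mul_eq_one_right (simpleReflection_mul_self _))
  obtain ⟨σ, rfl⟩ := hx
  rcases key _ (QuotientGroup.eq.mp hxy) with h | h
  · refine ⟨Fin.snoc σ false, ?_⟩
    rw [ev_succ]
    simp only [Fin.init_snoc, Fin.snoc_last]
    rw [inv_mul_eq_one] at h
    simpa using h
  · refine ⟨Fin.snoc σ true, ?_⟩
    rw [ev_succ]
    simp only [Fin.init_snoc, Fin.snoc_last]
    rw [inv_mul_eq_iff_eq_mul] at h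
    simpa using h.symm

variable (F) in
/-- The support of the Bott-Samelson sheaf of `s` is contained in `J(s)`. -/
theorem bottSamelson_supportedOn : ∀ {l : ℕ} (s : Fin l → SimpleAffineRoot b),
    (bottSamelson F b s).SupportedOn (J s)
  | 0, s => fun x hx m => by
    have h : x ≠ (1 : affineWeylGroup P) := by
      rintro rfl
      exact hx ⟨Fin.elim0, by simp [ev]⟩
    obtain ⟨m, hm⟩ := m
    have hm' := hm
    rw [if_neg h, Submodule.mem_bot] at hm'
    exact Subtype.ext hm'
  | l + 1, s => fun x hx m => by
    have key : ∀ m : OnStalk (bottSamelson F b (Fin.init s)) (x : affineWeylGroup P ⧸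
        Subgroup.closure {simpleReflection b (s (Fin.last l))}), m = 0 := fun m =>
      Subtype.ext (funext fun y => bottSamelson_supportedOn (Fin.init s) y.1
        (fun hy => hx (J_mul_mem s hy y.2)) (m.1 y))
    exact key m

instance bottSamelsonSectionsModule {l : ℕ} (s : Fin l → SimpleAffineRoot b) :
    Module (structureAlgebra (affineGraph F b) (J s)) (bottSamelson F b s).globalSections :=
  sectionsModule (bottSamelson_supportedOn F s)

instance bottSamelsonSectionsSMul {l : ℕ} (s : Fin l → SimpleAffineRoot b) :
    SMul (structureAlgebra (affineGraph F b) (J s)) (bottSamelson F b s).globalSections :=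
  (bottSamelsonSectionsModule s).toSMul

variable (F)

/-- The function `c^β : x ↦ x(β)`, with values in `S`. -/
def weightFunction (β : AffineWeight P) (x : affineWeylGroup P) : SymAlg F P :=
  SymmetricAlgebra.ι F (LabelSpace F P) (reduceWeight F (weightAct P x β))

/-- The diagonal embedding. -/
def diagonal (P : RootPairing ι ℚ V N) (l : ℕ) :
    (Subseq l → SymAlg F P) →ₗ[SymAlg F P] (Subseq (l + 1) → SymAlg F P) :=
  LinearMap.funLeft _ _ Fin.init

/-- The action of `c^α` on functions on subsequences of `s`, where `α` is the simple affine root of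
the last entry of `s`. -/
def mulLastRoot {l : ℕ} (s : Fin (l + 1) → SimpleAffineRoot b) :
    (Subseq (l + 1) → SymAlg F P) →ₗ[SymAlg F P] (Subseq (l + 1) → SymAlg F P) :=
  LinearMap.pi fun σ => weightFunction F
    (AffineRoot.toWeight P (SimpleAffineRoot.toRoot b (s (Fin.last l)))) (ev s σ) •
      LinearMap.proj σ

/-- The module `X(s)`, defined by `X(∅) = S` and `X(s) = Δ(X(s')) + c^α Δ(X(s'))`. -/
def fiebigModule : ∀ {l : ℕ}, (Fin l → SimpleAffineRoot b) →
    Submodule (SymAlg F P) (Subseq l → SymAlg F P)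
  | 0, _ => ⊤
  | l + 1, s => (fiebigModule (l := l) (Fin.init s)).map (diagonal F P l) ⊔
      ((fiebigModule (l := l) (Fin.init s)).map (diagonal F P l)).map (mulLastRoot F s)

/-- The restriction of functions to the subsequences with product `x`. -/
def restrictTo {l : ℕ} (s : Fin l → SimpleAffineRoot b) (x : affineWeylGroup P) :
    (Subseq l → SymAlg F P) →ₗ[SymAlg F P] ({σ : Subseq l // ev s σ = x} → SymAlg F P) :=
  LinearMap.funLeft _ _ Subtype.val

/-- The stalk `X(s)^x`. -/
abbrev fiebigStalk {l : ℕ} (s : Fin l → SimpleAffineRoot b) (x : affineWeylGroup P) :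
    Submodule (SymAlg F P) ({σ : Subseq l // ev s σ = x} → SymAlg F P) :=
  (fiebigModule F s).map (restrictTo F s x)

variable {F}

/-- The action of the local structure algebra `𝒵(J(s))` on functions on the subsequences of `s`:
`(z f) σ = z (ev σ) * f σ`. -/
def zAct {l : ℕ} (s : Fin l → SimpleAffineRoot b) (z : structureAlgebra (affineGraph F b) (J s))
    (f : Subseq l → SymAlg F P) : Subseq l → SymAlg F P :=
  fun σ => z.1 ⟨ev s σ, ev_mem_J s σ⟩ * f σ

variable (F) in
/-- `X(s)` is stable under the action of `𝒵(J(s))`. -/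
def IsZStable {l : ℕ} (s : Fin l → SimpleAffineRoot b) : Prop :=
  ∀ (z : structureAlgebra (affineGraph F b) (J s)), ∀ f ∈ fiebigModule F s,
    zAct s z f ∈ fiebigModule F s

/-- The `𝒵(J(s))`-module structure on `X(s)`, provided that `X(s)` is stable under the action
of `𝒵(J(s))`. -/
abbrev fiebigZModule {l : ℕ} {s : Fin l → SimpleAffineRoot b} (h : IsZStable F s) :
    Module (structureAlgebra (affineGraph F b) (J s)) (fiebigModule F s) where
  smul z f := ⟨zAct s z f.1, h z f.1 f.2⟩
  one_smul f := Subtype.ext (funext fun σ => one_mul (f.1 σ))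
  mul_smul _ _ f := Subtype.ext (funext fun σ => mul_assoc _ _ (f.1 σ))
  smul_zero _ := Subtype.ext (funext fun _ => mul_zero _)
  smul_add _ f g := Subtype.ext (funext fun σ => mul_add _ (f.1 σ) (g.1 σ))
  add_smul _ _ f := Subtype.ext (funext fun σ => add_mul _ _ (f.1 σ))
  zero_smul f := Subtype.ext (funext fun σ => zero_mul (f.1 σ))

/-- The restriction map `X(s) → X(s)^x`. -/
def fiebigRestriction {l : ℕ} (s : Fin l → SimpleAffineRoot b) (x : affineWeylGroup P)
    (f : fiebigModule F s) : fiebigStalk F s x :=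
  ⟨restrictTo F s x f.1, Submodule.mem_map_of_mem f.2⟩

end AffineGraphs

end

end BottSamelson

open BottSamelson

set_option linter.unusedSectionVars false

/-! The recursion defining X(s) is the shadow of one fact about sheaves: Γ(ϑ^s M) = Γ(M) + c^α Γ(M),
where α is the simple affine root of s. An element of the stalk of ϑ^s M at x is a section of M over
{x, xs}, so a global section m of ϑ^s M attaches to each coset two sections m_x and m_{xs} of M over
it. As 2 is invertible, m_x = g + xα · h, where g is half the sum of m_x and m_{xs}, and xα · h is
half their difference. The quotient h exists because ϑ_out imposes a congruence modulo the label ±xα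
of the edge between x and xs. It depends only on the coset, because difference and divisor both
change sign under x ↦ xs.

Along any other edge E from x to y, compatibility of g and of xα · h comes from that of m along E
and along its translate Es. To pass from xα · h to h one divides by xα in M^E. This is where GKM
enters: xα is not proportional to l(E), hence acts injectively on M^E. The result is
`exists_eq_add_of_mem_globalSections_theta`; the converse, `mem_globalSections_theta_of_eq_add`,
only needs that c^α satisfies the congruences of the structure algebra.

The divisions require that linear forms act on the stalks of M as on a polynomial ring and that M^E
is the stalk at the upper end of E modulo l(E). The gluing over cosets also requires global sections
to surject onto stalks. `Sheaf.IsTranslatable` collects these conditions; they hold for B(e) and are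
inherited by translates (`isTranslatable_theta`). Two facts on the affine Weyl group are used: J(s)
contains the lower end of each edge whose upper end it contains, and Es is again an edge unless E
joins x and xs. Both hold because a simple reflection permutes the positive affine roots other than
its own.

Finally, the stalk at x is embedded into the functions on the σ with ev(σ) = x by reading, for the
truncation σ', the component at ev(σ'), which lies in {x, xs}, and iterating. By induction with the
decomposition above, the image of the global sections is X(s); surjectivity onto stalks then
identifies the image of each stalk with X(s)^x. -/

namespace BottSamelson

noncomputable section

/-! ### Affine roots, their reflections and the dual action -/

section AffineRoots

variable {ι V N : Type v} [AddCommGroup V] [Module ℚ V] [AddCommGroup N] [Module ℚ N]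
variable {P : RootPairing ι ℚ V N}

theorem dualAct_add (w : N ≃ᵃ[ℚ] N) (β β' : V × ℚ) :
    dualAct P w (β + β') = dualAct P w β + dualAct P w β' := by
  have h (γ γ' : V × ℚ) (v : N) :
      levelOnePairing P (γ + γ') v = levelOnePairing P γ v + levelOnePairing P γ' v := by
    simp only [levelOnePairing, Prod.fst_add, Prod.snd_add, map_add, LinearMap.add_apply]
    ring
  refine levelOnePairing_injective P fun v => ?_
  simp only [h, levelOnePairing_dualAct]

theorem affineWeightCoe_add (β β' : AffineWeight P) :
    affineWeightCoe P (β + β') = affineWeightCoe P β + affineWeightCoe P β' := by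
  simp [affineWeightCoe]

/-- The negative of an affine root. -/
def AffineRoot.opp (γ : AffineRoot P) : AffineRoot P := (P.reflectionPerm γ.1 γ.1, -γ.2)

theorem rootReflection_opp (γ : AffineRoot P) : rootReflection P γ.opp = rootReflection P γ := by
  refine Subtype.ext (AffineEquiv.ext fun v => ?_)
  change v - (P.toLinearMap (P.root (P.reflectionPerm γ.1 γ.1)) v - ((- -γ.2 : ℤ) : ℚ)) •
    P.coroot (P.reflectionPerm γ.1 γ.1) =
    v - (P.toLinearMap (P.root γ.1) v - ((-γ.2 : ℤ) : ℚ)) • P.coroot γ.1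
  simp
  module

theorem rootReflection_mul_self (γ : AffineRoot P) :
    rootReflection P γ * rootReflection P γ = 1 :=
  Subtype.ext (AffineEquiv.ext fun v => (affineReflection P γ.1 (-γ.2)).left_inv v)

theorem rootReflection_inv (γ : AffineRoot P) : (rootReflection P γ)⁻¹ = rootReflection P γ :=
  inv_eq_of_mul_eq_one_right (rootReflection_mul_self γ)

variable [P.IsCrystallographic]

theorem weightAct_one (β : AffineWeight P) : weightAct P 1 β = β :=
  affineWeightCoe_injective P (by
    rw [affineWeightCoe_weightAct]; exact dualAct_one P _)

theorem weightAct_mul (w w' : affineWeylGroup P) (β : AffineWeight P) :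
    weightAct P (w * w') β = weightAct P w (weightAct P w' β) :=
  affineWeightCoe_injective P (by
    rw [affineWeightCoe_weightAct, affineWeightCoe_weightAct, affineWeightCoe_weightAct]
    exact dualAct_mul P _ _ _)

/-- The action of an element of the affine Weyl group on affine weights, as a homomorphism. -/
def weightActHom (w : affineWeylGroup P) : AffineWeight P →+ AffineWeight P :=
  AddMonoidHom.mk' (weightAct P w) fun β β' => affineWeightCoe_injective P (by
    rw [affineWeightCoe_weightAct, affineWeightCoe_add, affineWeightCoe_add, dualAct_add,
      affineWeightCoe_weightAct, affineWeightCoe_weightAct])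

theorem weightAct_neg (w : affineWeylGroup P) (β : AffineWeight P) :
    weightAct P w (-β) = -weightAct P w β := map_neg (weightActHom w) β

theorem weightAct_inv_weightAct (w : affineWeylGroup P) (β : AffineWeight P) :
    weightAct P w⁻¹ (weightAct P w β) = β := by
  rw [← weightAct_mul, inv_mul_cancel, weightAct_one]

theorem weightAct_weightAct_inv (w : affineWeylGroup P) (β : AffineWeight P) :
    weightAct P w (weightAct P w⁻¹ β) = β := by
  rw [← weightAct_mul, mul_inv_cancel, weightAct_one]

theorem toWeight_injective : Function.Injective (AffineRoot.toWeight P) := by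
  rintro ⟨i, m⟩ ⟨j, n⟩ h
  simp only [AffineRoot.toWeight, Prod.mk.injEq, Subtype.mk.injEq,
    EmbeddingLike.apply_eq_iff_eq] at h
  exact Prod.ext h.1 h.2

theorem weightAct_rootReflection (γ : AffineRoot P) (β : AffineWeight P) (c : ℤ)
    (hc : P.toLinearMap β.1 (P.coroot γ.1) = c) :
    weightAct P (rootReflection P γ) β = β - c • AffineRoot.toWeight P γ := by
  apply affineWeightCoe_injective P
  rw [affineWeightCoe_weightAct]
  simp only [rootReflection, dualAct_affineReflection]
  simp only [affineWeightCoe, hc]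
  ext <;> simp [AffineRoot.toWeight, ← Int.cast_smul_eq_zsmul ℚ]

theorem exists_weightAct_rootReflection (γ : AffineRoot P) (β : AffineWeight P) :
    ∃ c : ℤ, weightAct P (rootReflection P γ) β = β - c • AffineRoot.toWeight P γ := by
  obtain ⟨c, hc⟩ := β.1.2 γ.1
  exact ⟨c, weightAct_rootReflection γ β c hc⟩

theorem weightAct_rootReflection_toWeight (γ δ : AffineRoot P) :
    weightAct P (rootReflection P γ) (AffineRoot.toWeight P δ) =
      AffineRoot.toWeight P δ - P.pairingIn ℤ δ.1 γ.1 • AffineRoot.toWeight P γ :=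
  weightAct_rootReflection γ _ _ (by
    change P.toLinearMap (P.root δ.1) (P.coroot γ.1) = _
    rw [P.root_coroot_eq_pairing, ← P.algebraMap_pairingIn ℤ, eq_intCast])

theorem weightAct_rootReflection_self (γ : AffineRoot P) :
    weightAct P (rootReflection P γ) (AffineRoot.toWeight P γ) = -AffineRoot.toWeight P γ := by
  rw [weightAct_rootReflection_toWeight]
  simp only [RootPairing.pairingIn_same]
  abel

theorem toWeight_opp (γ : AffineRoot P) :
    AffineRoot.toWeight P γ.opp = -AffineRoot.toWeight P γ := by
  ext <;> simp [AffineRoot.opp, AffineRoot.toWeight]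

/-- The image of the affine root `δ` under the reflection in `γ`. -/
def AffineRoot.refl (γ δ : AffineRoot P) : AffineRoot P :=
  (P.reflectionPerm γ.1 δ.1, δ.2 - P.pairingIn ℤ δ.1 γ.1 * γ.2)

theorem toWeight_refl (γ δ : AffineRoot P) :
    AffineRoot.toWeight P (γ.refl δ) =
      weightAct P (rootReflection P γ) (AffineRoot.toWeight P δ) := by
  rw [weightAct_rootReflection_toWeight]
  ext
  · have h : ((P.pairingIn ℤ δ.1 γ.1 : ℤ) : ℚ) = P.pairing δ.1 γ.1 := by
      rw [← P.algebraMap_pairingIn ℤ, eq_intCast]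
    simp [AffineRoot.refl, AffineRoot.toWeight, RootPairing.reflection_apply, ← h,
      ← Int.cast_smul_eq_zsmul ℚ]
  · simp [AffineRoot.refl, AffineRoot.toWeight]

theorem rootReflection_refl (γ δ : AffineRoot P) :
    rootReflection P (γ.refl δ) =
      rootReflection P γ * rootReflection P δ * (rootReflection P γ)⁻¹ := by
  rw [rootReflection_inv]
  refine Subtype.ext (AffineEquiv.ext fun v => ?_)
  have h : ((P.pairingIn ℤ δ.1 γ.1 : ℤ) : ℚ) = P.pairing δ.1 γ.1 := by
    rw [← P.algebraMap_pairingIn ℤ, eq_intCast]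
  change v - (P.toLinearMap (P.root (P.reflectionPerm γ.1 δ.1)) v -
    ((-(δ.2 - P.pairingIn ℤ δ.1 γ.1 * γ.2) : ℤ) : ℚ)) • P.coroot (P.reflectionPerm γ.1 δ.1) =
    affineReflection P γ.1 (-γ.2) (affineReflection P δ.1 (-δ.2) (affineReflection P γ.1 (-γ.2) v))
  have h2 (i : ι) (n : ℤ) (v : N) : affineReflection P i n v =
    v - (P.toLinearMap (P.root i) v - n) • P.coroot i := rfl
  simp only [h2]
  simp only [RootPairing.root_reflectionPerm, RootPairing.coroot_reflectionPerm,
    RootPairing.reflection_apply, RootPairing.coreflection_apply, map_sub, map_smul,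
    LinearMap.sub_apply, LinearMap.smul_apply, smul_eq_mul, P.root_coroot_eq_pairing,
    RootPairing.pairing_same]
  push_cast
  rw [h]
  simp only [LinearMap.flip_apply, RootPairing.coroot', P.root_coroot_eq_pairing]
  module

/-- The group permutes the affine roots, and forming reflections is equivariant. Induction on a
product of generators reduces this to the case where w is one reflection. -/
theorem exists_toWeight_eq_weightAct (w : affineWeylGroup P) (γ : AffineRoot P) :
    ∃ γ', AffineRoot.toWeight P γ' = weightAct P w (AffineRoot.toWeight P γ) ∧
      rootReflection P γ' = w * rootReflection P γ * w⁻¹ := by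
  obtain ⟨w, hw⟩ := w
  induction hw using Subgroup.closure_induction_left generalizing γ with
  | one => exact ⟨γ, (weightAct_one _).symm, by
      rw [show (⟨1, _⟩ : affineWeylGroup P) = 1 from rfl]; simp⟩
  | mul_left x hx y hy ih =>
    obtain ⟨⟨i, n⟩, rfl⟩ := hx
    obtain ⟨γ', h1, h2⟩ := ih γ
    -- With the sign convention s_{(α,n)} = s_{α,-n}, the generator s_{α,n} is the reflection in the
    -- affine root (α, -n).
    have hw : (⟨affineReflection P i n * y, mul_mem (Subgroup.subset_closure ⟨(i, n), rfl⟩) hy⟩ :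
        affineWeylGroup P) = rootReflection P (i, -n) * ⟨y, hy⟩ :=
      Subtype.ext (by simp [rootReflection])
    refine ⟨AffineRoot.refl (i, -n) γ', ?_, ?_⟩
    · rw [toWeight_refl, h1, ← weightAct_mul, ← hw]
    · rw [rootReflection_refl, h2]
      simp only [hw]
      group
  | inv_mul_cancel x hx y hy ih =>
    obtain ⟨⟨i, n⟩, rfl⟩ := hx
    obtain ⟨γ', h1, h2⟩ := ih γ
    have hw : (⟨(affineReflection P i n)⁻¹ * y,
        mul_mem (inv_mem (Subgroup.subset_closure ⟨(i, n), rfl⟩)) hy⟩ :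
        affineWeylGroup P) = rootReflection P (i, -n) * ⟨y, hy⟩ :=
      Subtype.ext (by simp [rootReflection, affineReflection_inv])
    refine ⟨AffineRoot.refl (i, -n) γ', ?_, ?_⟩
    · rw [toWeight_refl, h1, ← weightAct_mul, ← hw]
    · rw [rootReflection_refl, h2]
      simp only [hw]
      group

theorem rootReflection_of_toWeight_eq {w : affineWeylGroup P} {γ γ' : AffineRoot P}
    (h : AffineRoot.toWeight P γ' = weightAct P w (AffineRoot.toWeight P γ)) :
    rootReflection P γ' = w * rootReflection P γ * w⁻¹ := by
  obtain ⟨δ, h1, h2⟩ := exists_toWeight_eq_weightAct w γ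
  rwa [toWeight_injective (h.trans h1.symm)]

variable [Finite ι] [P.IsReduced]

/-- Applying the common reflection to γ in two ways gives -γ = γ - cγ', that is 2γ = cγ'.
Reducedness makes the finite parts equal up to sign, so c = ±2, and then the integral parts agree up
to the same sign. -/
theorem eq_or_eq_opp_of_rootReflection_eq {γ γ' : AffineRoot P}
    (h : rootReflection P γ = rootReflection P γ') : γ = γ' ∨ γ = γ'.opp := by
  have h1 := weightAct_rootReflection_self γ
  rw [h, weightAct_rootReflection_toWeight, sub_eq_iff_eq_add] at h1
  set c := P.pairingIn ℤ γ.1 γ'.1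
  have h2 : (2 : ℤ) • AffineRoot.toWeight P γ = c • AffineRoot.toWeight P γ' := by
    linear_combination (norm := module) h1
  have h3 : (2 : ℚ) • P.root γ.1 = (c : ℚ) • P.root γ'.1 := by
    have := congrArg (fun β : AffineWeight P => ((β.1 : weightLattice P) : V)) h2
    simpa [AffineRoot.toWeight, ← Int.cast_smul_eq_zsmul ℚ] using this
  have h4 : 2 * γ.2 = c * γ'.2 := by
    have := congrArg (fun β : AffineWeight P => β.2) h2
    simpa [AffineRoot.toWeight] using this
  have hr : P.root γ'.1 ≠ 0 := P.ne_zero _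
  rcases RootPairing.IsReduced.eq_or_eq_neg (P := P) γ.1 γ'.1 (by
    rw [LinearIndependent.pair_iff]
    push Not
    refine ⟨2, -c, ?_, fun h => absurd h two_ne_zero⟩
    rw [h3]; module) with h5 | h5
  · left
    rw [h5] at h3
    have h6 : (2 : ℚ) = c := smul_left_injective ℚ hr h3
    have h7 : (2 : ℤ) = c := by exact_mod_cast h6
    rw [← h7] at h4
    exact Prod.ext (P.root.injective h5) (by linarith)
  · right
    rw [h5, smul_neg, ← neg_smul] at h3
    have h6 : (-2 : ℚ) = c := smul_left_injective ℚ hr h3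
    have h7 : (-2 : ℤ) = c := by exact_mod_cast h6
    rw [← h7] at h4
    exact Prod.ext (P.root.injective (by simp [AffineRoot.opp, h5]))
      (by simp only [AffineRoot.opp]; linarith)

end AffineRoots

/-! ### Positive affine roots and generation by simple reflections -/

section AffinePositive

variable {ι V N : Type v} [Finite ι] [AddCommGroup V] [Module ℚ V] [AddCommGroup N] [Module ℚ N]
variable {P : RootPairing ι ℚ V N} [P.IsCrystallographic] [P.IsRootSystem] [P.IsReduced]
  [P.IsIrreducible] (b : P.Base)

/-- A simple affine root, viewed as an affine weight. -/
abbrev simpleWeight (a : SimpleAffineRoot b) : AffineWeight P :=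
  AffineRoot.toWeight P (SimpleAffineRoot.toRoot b a)

theorem mem_closure_simpleWeight {x : V} (hx : x ∈ AddSubmonoid.closure (P.root '' b.support)) :
    ∃ h : x ∈ weightLattice P,
      ((⟨x, h⟩, 0) : AffineWeight P) ∈ AddSubmonoid.closure (Set.range (simpleWeight b)) := by
  induction hx using AddSubmonoid.closure_induction with
  | mem x hx =>
    obtain ⟨i, hi, rfl⟩ := hx
    exact ⟨root_mem_weightLattice P i, AddSubmonoid.subset_closure ⟨some ⟨i, hi⟩, rfl⟩⟩
  | zero => exact ⟨zero_mem _, zero_mem _⟩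
  | add x y _ _ hx hy =>
    obtain ⟨hx, hx'⟩ := hx
    obtain ⟨hy, hy'⟩ := hy
    exact ⟨add_mem hx hy, add_mem hx' hy'⟩

variable {b}

theorem root_mem_closure_of_isPos {i : ι} (hi : b.IsPos i) :
    P.root i ∈ AddSubmonoid.closure (P.root '' b.support) := by
  obtain ⟨f, -, h | h⟩ := b.exists_root_eq_sum_nat_or_neg i
  · rw [h]
    exact sum_mem fun j hj =>
      nsmul_mem (AddSubmonoid.subset_closure (Set.mem_image_of_mem _ hj)) _
  · exfalso
    have h2 : P.root i = ∑ j ∈ b.support, (-(f j : ℤ)) • P.root j := by simp [h]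
    rw [b.isPos_iff, RootPairing.Base.height_eq_sum h2] at hi
    exact absurd hi (not_lt.mpr (Finset.sum_nonpos fun i _ => by simp))

theorem highestRoot_mem_closure :
    P.root (highestRoot b) ∈ AddSubmonoid.closure (P.root '' b.support) := by
  have : Nontrivial V := RootPairing.IsIrreducible.nontrivial P
  have hne : Nonempty ι := by
    by_contra h
    rw [not_nonempty_iff] at h
    have h1 := RootPairing.IsRootSystem.span_root_eq_top (P := P)
    rw [Set.range_eq_empty, Submodule.span_empty] at h1
    exact bot_ne_top h1
  obtain ⟨s, hs⟩ := b.support_nonempty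
  have := add_mem ((exists_highestRoot b).choose_spec s)
    (AddSubmonoid.subset_closure (Set.mem_image_of_mem P.root hs))
  rwa [sub_add_cancel] at this

/-- With θ the highest root, (α, m+1) = (m+1)(-θ, 1) + (mθ + (θ + α), 0). Both θ and θ + α = θ -
(-α) are sums of simple roots, by the defining property of θ. -/
theorem toWeight_mem_closure {γ : AffineRoot P} (hγ : AffineRoot.IsPositive b γ) :
    AffineRoot.toWeight P γ ∈ AddSubmonoid.closure (Set.range (simpleWeight b)) := by
  obtain ⟨i, n⟩ := γ
  rcases hγ with h | ⟨h, h'⟩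
  · obtain ⟨m, rfl⟩ : ∃ m : ℕ, n = m + 1 := ⟨(n - 1).toNat, by simp only at h; omega⟩
    have h1 : (m + 1) • P.root (highestRoot b) + P.root i ∈
        AddSubmonoid.closure (P.root '' b.support) := by
      have h2 := (exists_highestRoot b).choose_spec (P.reflectionPerm i i)
      rw [RootPairing.root_reflectionPerm, RootPairing.reflection_apply_self, sub_neg_eq_add] at h2
      rw [succ_nsmul, add_assoc]
      exact add_mem (nsmul_mem highestRoot_mem_closure m) h2
    obtain ⟨h2, h3⟩ := mem_closure_simpleWeight b h1
    have h4 : AffineRoot.toWeight P (i, (m : ℤ) + 1) =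
        (m + 1) • simpleWeight b none + (⟨_, h2⟩, 0) := by
      ext
      · simp [AffineRoot.toWeight, simpleWeight, SimpleAffineRoot.toRoot]
      · simp [AffineRoot.toWeight, simpleWeight, SimpleAffineRoot.toRoot]
    rw [h4]
    exact add_mem (nsmul_mem (AddSubmonoid.subset_closure (Set.mem_range_self _)) _) h3
  · simp only at h h'
    subst h
    exact (mem_closure_simpleWeight b (root_mem_closure_of_isPos h')).2

theorem exists_toWeight_eq_sum {γ : AffineRoot P} (hγ : AffineRoot.IsPositive b γ) :
    ∃ k : SimpleAffineRoot b → ℕ, AffineRoot.toWeight P γ = ∑ a, k a • simpleWeight b a := by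
  classical
  have h := toWeight_mem_closure hγ
  generalize AffineRoot.toWeight P γ = x at h ⊢
  induction h using AddSubmonoid.closure_induction with
  | mem x hx =>
    obtain ⟨a, rfl⟩ := hx
    exact ⟨Pi.single a 1, by simp [Pi.single_apply, ite_smul]⟩
  | zero => exact ⟨0, by simp⟩
  | add x y _ _ hx hy =>
    obtain ⟨k, rfl⟩ := hx
    obtain ⟨k', rfl⟩ := hy
    exact ⟨k + k', by simp [add_smul, Finset.sum_add_distrib]⟩

/-- Only (-θ, 1) has a nonzero integral part, so its coefficient vanishes; what is left is a
relation among the simple roots of the finite system. -/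
theorem eq_zero_of_sum_simpleWeight {c : SimpleAffineRoot b → ℤ}
    (h : ∑ a, c a • simpleWeight b a = 0) : c = 0 := by
  rw [Fintype.sum_option] at h
  have h1 : c none = 0 := by
    have := congrArg (fun β : AffineWeight P => β.2) h
    simpa [simpleWeight, AffineRoot.toWeight, SimpleAffineRoot.toRoot, Prod.snd_sum] using this
  rw [h1, zero_smul, zero_add] at h
  have h2 := congrArg (fun β : AffineWeight P => ((β.1 : weightLattice P) : V)) h
  simp only [Prod.fst_sum, AddSubgroup.val_finsetSum] at h2
  have h3 := Fintype.linearIndependent_iff.mp (b.linearIndepOn_root.restrict_scalars' ℤ)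
    (fun i => c (some i)) (by simpa [simpleWeight, AffineRoot.toWeight,
      SimpleAffineRoot.toRoot] using! h2)
  funext a
  cases a with
  | none => exact h1
  | some i => exact h3 i

theorem sum_simpleWeight_injective {c c' : SimpleAffineRoot b → ℤ}
    (h : ∑ a, c a • simpleWeight b a = ∑ a, c' a • simpleWeight b a) : c = c' := by
  refine sub_eq_zero.mp (eq_zero_of_sum_simpleWeight (b := b) (c := c - c') ?_)
  simp [sub_smul, Finset.sum_sub_distrib, h]

theorem isPositive_or_opp (b : P.Base) (γ : AffineRoot P) :
    AffineRoot.IsPositive b γ ∨ AffineRoot.IsPositive b γ.opp := by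
  have := RootPairing.Base.IsPos.or_neg b γ.1
  rcases lt_trichotomy γ.2 0 with h | h | h
  · exact Or.inr (Or.inl (by simpa [AffineRoot.opp] using h))
  · exact this.imp (fun h' => Or.inr ⟨h, h'⟩) (fun h' => Or.inr ⟨by simp [AffineRoot.opp, h], h'⟩)
  · exact Or.inl (Or.inl h)

theorem not_isPositive_opp {γ : AffineRoot P} (hγ : AffineRoot.IsPositive b γ) :
    ¬ AffineRoot.IsPositive b γ.opp := by
  have := RootPairing.Base.IsPos.neg_iff_not b γ.1
  rintro (h | ⟨h, h'⟩)
  · simp only [AffineRoot.opp] at h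
    rcases hγ with h1 | h1 <;> omega
  · simp only [AffineRoot.opp] at h
    rcases hγ with h1 | h1
    · omega
    · exact this.mp h' h1.2

/-- An affine root which is a nonnegative multiple of another one is equal to it. -/
theorem eq_of_toWeight_eq_nsmul {γ δ : AffineRoot P} {n : ℕ}
    (h : AffineRoot.toWeight P γ = n • AffineRoot.toWeight P δ) : γ = δ := by
  have h1 : P.root γ.1 = (n : ℚ) • P.root δ.1 := by
    have := congrArg (fun β : AffineWeight P => ((β.1 : weightLattice P) : V)) h
    simpa [AffineRoot.toWeight, Nat.cast_smul_eq_nsmul] using this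
  have h2 : γ.2 = n * δ.2 := by
    have := congrArg (fun β : AffineWeight P => β.2) h
    simpa [AffineRoot.toWeight] using this
  have hr : P.root δ.1 ≠ 0 := P.ne_zero _
  rcases RootPairing.IsReduced.eq_or_eq_neg (P := P) γ.1 δ.1 (by
    rw [LinearIndependent.pair_iff]
    push Not
    refine ⟨1, -n, ?_, fun h => absurd h one_ne_zero⟩
    rw [h1]; module) with h5 | h5
  · rw [h5] at h1
    have h6 : (n : ℚ) = 1 := smul_left_injective ℚ hr (by simpa using h1.symm)
    have h7 : n = 1 := by exact_mod_cast h6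
    exact Prod.ext (P.root.injective h5) (by simp [h2, h7])
  · rw [h5] at h1
    have h6 : (n : ℚ) = -1 := smul_left_injective ℚ hr (by simpa using h1.symm)
    have : (0 : ℚ) ≤ n := n.cast_nonneg
    linarith

/-- A simple reflection permutes the positive affine roots other than its own. -/
theorem isPositive_refl {a : SimpleAffineRoot b} {γ : AffineRoot P}
    (hγ : AffineRoot.IsPositive b γ) (hne : γ ≠ SimpleAffineRoot.toRoot b a) :
    AffineRoot.IsPositive b ((SimpleAffineRoot.toRoot b a).refl γ) := by
  classical
  refine (isPositive_or_opp b _).resolve_right fun hneg => hne ?_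
  obtain ⟨k, hk⟩ := exists_toWeight_eq_sum hγ
  obtain ⟨k', hk'⟩ := exists_toWeight_eq_sum hneg
  rw [toWeight_opp, toWeight_refl, weightAct_rootReflection_toWeight, neg_sub] at hk'
  set c := P.pairingIn ℤ γ.1 (SimpleAffineRoot.toRoot b a).1
  -- If the reflected root were negative, both γ and cα_a - γ would be nonnegative combinations of
  -- simple affine roots. They add up to cα_a, so γ involves only α_a and must equal it.
  have h1 : ∑ a', ((k a' : ℤ) + k' a') • simpleWeight b a' =
      ∑ a', (Pi.single a c : SimpleAffineRoot b → ℤ) a' • simpleWeight b a' := by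
    simp only [add_smul, Finset.sum_add_distrib, natCast_zsmul, ← hk, ← hk']
    simp [Pi.single_apply, ite_smul]
  have h2 := sum_simpleWeight_injective h1
  have h3 : ∀ a', a' ≠ a → k a' = 0 := fun a' ha' => by
    have := congrFun h2 a'
    simp only [Pi.single_eq_of_ne ha'] at this
    omega
  rw [Finset.sum_eq_single a (fun a' _ ha' => by rw [h3 a' ha', zero_smul])
    (fun h => absurd (Finset.mem_univ _) h)] at hk
  exact eq_of_toWeight_eq_nsmul hk

/-- The product of a word in the simple reflections. -/
def wordProd (b : P.Base) (L : List (SimpleAffineRoot b)) : affineWeylGroup P :=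
  (L.map (simpleReflection b)).prod

/-- Every positive affine root is conjugate to a simple one. -/
theorem exists_word_toWeight_eq {γ : AffineRoot P} (hγ : AffineRoot.IsPositive b γ) :
    ∃ (L : List (SimpleAffineRoot b)) (a : SimpleAffineRoot b),
      AffineRoot.toWeight P γ = weightAct P (wordProd b L) (simpleWeight b a) := by
  classical
  obtain ⟨k, hk⟩ := exists_toWeight_eq_sum hγ
  -- The induction is on the height of γ; reflecting in a simple root that pairs positively with γ
  -- lowers it.
  induction hn : ∑ a, k a using Nat.strong_induction_on generalizing γ k with
  | _ n ih =>
  by_cases hs : ∃ a, γ = SimpleAffineRoot.toRoot b a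
  · obtain ⟨a, rfl⟩ := hs
    exact ⟨[], a, by simp [wordProd, weightAct_one]⟩
  push Not at hs
  -- Otherwise 2 = ⟨γ, γ^∨⟩ would be a sum of nonpositive terms k_a ⟨α_a, γ^∨⟩.
  obtain ⟨a, ha⟩ : ∃ a : SimpleAffineRoot b,
      0 < P.pairingIn ℤ (SimpleAffineRoot.toRoot b a).1 γ.1 := by
    by_contra! hcon
    have h1 : (2 : ℚ) = ∑ a, (k a : ℚ) * P.pairing (SimpleAffineRoot.toRoot b a).1 γ.1 := by
      have h2 := congrArg (fun β : AffineWeight P =>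
        P.toLinearMap ((β.1 : weightLattice P) : V) (P.coroot γ.1)) hk
      simpa [AffineRoot.toWeight, Prod.fst_sum, simpleWeight, P.root_coroot_eq_pairing] using h2
    have h2 : ∑ a, (k a : ℚ) * P.pairing (SimpleAffineRoot.toRoot b a).1 γ.1 ≤ 0 := by
      refine Finset.sum_nonpos fun a _ => mul_nonpos_of_nonneg_of_nonpos (Nat.cast_nonneg _) ?_
      rw [← P.algebraMap_pairingIn ℤ, eq_intCast]
      exact_mod_cast hcon a
    linarith
  have ha' : 0 < P.pairingIn ℤ γ.1 (SimpleAffineRoot.toRoot b a).1 := by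
    rwa [P.zero_lt_pairingIn_iff']
  have hpos := isPositive_refl hγ (hs a)
  obtain ⟨k', hk'⟩ := exists_toWeight_eq_sum hpos
  have hw := hk'
  rw [toWeight_refl, weightAct_rootReflection_toWeight] at hk'
  set c := P.pairingIn ℤ γ.1 (SimpleAffineRoot.toRoot b a).1
  have h1 : ∑ a', ((k' a' : ℤ) + (Pi.single a c : SimpleAffineRoot b → ℤ) a') • simpleWeight b a' =
      ∑ a', (k a' : ℤ) • simpleWeight b a' := by
    simp only [add_smul, Finset.sum_add_distrib, natCast_zsmul, ← hk, ← hk']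
    simp [Pi.single_apply, ite_smul]
  have h2 := sum_simpleWeight_injective h1
  have h3 : (∑ a, k' a : ℤ) + c = n := by
    rw [← hn]
    push_cast
    rw [← Finset.sum_congr rfl fun a _ => congrFun h2 a, Finset.sum_add_distrib]
    simp
  obtain ⟨L, a', h4⟩ := ih (∑ a, k' a) (by zify; omega) hpos k' hw rfl
  refine ⟨a :: L, a', ?_⟩
  rw [wordProd, List.map_cons, List.prod_cons, weightAct_mul, ← wordProd, ← h4, toWeight_refl,
    ← weightAct_mul, simpleReflection, rootReflection_mul_self, weightAct_one]

theorem wordProd_append (L L' : List (SimpleAffineRoot b)) :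
    wordProd b (L ++ L') = wordProd b L * wordProd b L' := by simp [wordProd]

theorem wordProd_reverse (L : List (SimpleAffineRoot b)) :
    wordProd b L.reverse = (wordProd b L)⁻¹ := by
  induction L with
  | nil => simp [wordProd]
  | cons a L ih =>
    rw [List.reverse_cons, wordProd_append, ih]
    simp [wordProd, simpleReflection, rootReflection_inv]

theorem exists_isPositive_rootReflection_eq (b : P.Base) (γ : AffineRoot P) :
    ∃ γ', AffineRoot.IsPositive b γ' ∧ rootReflection P γ' = rootReflection P γ := by
  rcases isPositive_or_opp b γ with h | h
  · exact ⟨γ, h, rfl⟩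
  · exact ⟨_, h, rootReflection_opp γ⟩

theorem exists_word_rootReflection_eq (b : P.Base) (γ : AffineRoot P) :
    ∃ (L : List (SimpleAffineRoot b)) (a : SimpleAffineRoot b),
      rootReflection P γ = wordProd b L * simpleReflection b a * (wordProd b L)⁻¹ := by
  obtain ⟨γ', h, h'⟩ := exists_isPositive_rootReflection_eq b γ
  obtain ⟨L, a, hL⟩ := exists_word_toWeight_eq h
  exact ⟨L, a, by rw [← h', rootReflection_of_toWeight_eq hL]; rfl⟩

/-- The affine Weyl group is generated by the simple reflections. -/
theorem exists_wordProd_eq (b : P.Base) (w : affineWeylGroup P) :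
    ∃ L : List (SimpleAffineRoot b), wordProd b L = w := by
  have key (i : ι) (n : ℤ) : ∃ L : List (SimpleAffineRoot b),
      wordProd b L = rootReflection P (i, -n) := by
    obtain ⟨L, a, h⟩ := exists_word_rootReflection_eq b (i, -n)
    refine ⟨L ++ ([a] ++ L.reverse), ?_⟩
    rw [wordProd_append, wordProd_append, wordProd_reverse, h, mul_assoc]
    simp [wordProd]
  obtain ⟨w, hw⟩ := w
  induction hw using Subgroup.closure_induction with
  | mem x hx =>
    obtain ⟨⟨i, n⟩, rfl⟩ := hx
    obtain ⟨L, hL⟩ := key i n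
    exact ⟨L, hL.trans (Subtype.ext (by simp [rootReflection]))⟩
  | one => exact ⟨[], rfl⟩
  | mul x y _ _ hx hy =>
    obtain ⟨L, hL⟩ := hx
    obtain ⟨L', hL'⟩ := hy
    exact ⟨L ++ L', by rw [wordProd_append, hL, hL']; rfl⟩
  | inv x _ hx =>
    obtain ⟨L, hL⟩ := hx
    exact ⟨L.reverse, by rw [wordProd_reverse, hL]; rfl⟩

end AffinePositive

/-! ### Inversions, the exchange condition and edges of the moment graph -/

section BruhatEdges

variable {ι V N : Type v} [Finite ι] [AddCommGroup V] [Module ℚ V] [AddCommGroup N] [Module ℚ N]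
variable {P : RootPairing ι ℚ V N} [P.IsCrystallographic] [P.IsRootSystem] [P.IsReduced]
  [P.IsIrreducible] {b : P.Base}

variable (b) in
/-- The affine root `γ` is sent by `w⁻¹` to a negative affine root. -/
def IsInversion (γ : AffineRoot P) (w : affineWeylGroup P) : Prop :=
  ∃ δ, AffineRoot.IsPositive b δ ∧
    weightAct P w⁻¹ (AffineRoot.toWeight P γ) = -AffineRoot.toWeight P δ

theorem not_isInversion_iff {γ : AffineRoot P} {w : affineWeylGroup P} :
    ¬ IsInversion b γ w ↔ ∃ δ, AffineRoot.IsPositive b δ ∧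
      AffineRoot.toWeight P δ = weightAct P w⁻¹ (AffineRoot.toWeight P γ) := by
  obtain ⟨ε, hε, -⟩ := exists_toWeight_eq_weightAct w⁻¹ γ
  constructor
  · intro h
    refine ⟨ε, (isPositive_or_opp b ε).resolve_right fun h' => h ⟨_, h', ?_⟩, hε⟩
    rw [toWeight_opp, neg_neg, hε]
  · rintro ⟨δ, hδ, h⟩ ⟨δ', hδ', h'⟩
    rw [← h, ← toWeight_opp] at h'
    exact not_isPositive_opp hδ' (toWeight_injective h' ▸ hδ)

theorem isInversion_rootReflection_mul_iff {γ : AffineRoot P} {w : affineWeylGroup P} :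
    IsInversion b γ (rootReflection P γ * w) ↔ ¬ IsInversion b γ w := by
  rw [not_isInversion_iff, IsInversion]
  simp only [mul_inv_rev, rootReflection_inv, weightAct_mul, weightAct_rootReflection_self,
    weightAct_neg, neg_inj, eq_comm]

/-- The reflection s_a can make the positive root w⁻¹γ negative only if w⁻¹γ = α_a, and then s_γ = w
s_a w⁻¹. -/
theorem isInversion_mul_simpleReflection {γ : AffineRoot P} {w : affineWeylGroup P}
    {a : SimpleAffineRoot b} (h : IsInversion b γ (w * simpleReflection b a)) :
    IsInversion b γ w ∨ rootReflection P γ * w = w * simpleReflection b a := by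
  by_contra! hcon
  obtain ⟨h1, h2⟩ := hcon
  obtain ⟨ε, hε, h3⟩ := not_isInversion_iff.mp h1
  by_cases h4 : ε = SimpleAffineRoot.toRoot b a
  · refine h2 ?_
    have h5 : AffineRoot.toWeight P γ = weightAct P w (AffineRoot.toWeight P ε) := by
      rw [h3, weightAct_weightAct_inv]
    rw [rootReflection_of_toWeight_eq h5, h4, inv_mul_cancel_right]
    rfl
  · refine not_isInversion_iff.mpr ⟨_, isPositive_refl hε h4, ?_⟩ h
    rw [mul_inv_rev, weightAct_mul, toWeight_refl, h3, simpleReflection, rootReflection_inv]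

theorem not_isInversion_one {γ : AffineRoot P} (hγ : AffineRoot.IsPositive b γ) :
    ¬ IsInversion b γ 1 :=
  not_isInversion_iff.mpr ⟨γ, hγ, by rw [inv_one, weightAct_one]⟩

/-- The exchange condition, for words that need not be reduced. Letters are peeled off from the
right: either γ is still an inversion of the prefix, or the removed letter created the inversion,
and then deleting it amounts to multiplying by s_γ on the left. -/
theorem exists_shorter_word {γ : AffineRoot P} (hγ : AffineRoot.IsPositive b γ)
    (L : List (SimpleAffineRoot b)) (h : IsInversion b γ (wordProd b L)) :
    ∃ L' : List (SimpleAffineRoot b), L'.length < L.length ∧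
      wordProd b L' = rootReflection P γ * wordProd b L := by
  induction L using List.reverseRecOn with
  | nil => exact absurd h (not_isInversion_one hγ)
  | append_singleton L a ih =>
    have ha : wordProd b [a] = simpleReflection b a := by simp [wordProd]
    rw [wordProd_append, ha] at h
    rcases isInversion_mul_simpleReflection h with h | h
    · obtain ⟨L', h1, h2⟩ := ih h
      exact ⟨L' ++ [a], by simpa using h1, by rw [wordProd_append, h2, wordProd_append, mul_assoc]⟩
    · refine ⟨L, by simp, ?_⟩
      rw [wordProd_append, ha, ← mul_assoc, h, mul_assoc, simpleReflection, rootReflection_mul_self,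
        mul_one]

theorem length_lt_of_isInversion {γ : AffineRoot P} (hγ : AffineRoot.IsPositive b γ)
    {w : affineWeylGroup P} (h : IsInversion b γ w) :
    length b (rootReflection P γ * w) < length b w := by
  have hne : {n | ∃ L : List (SimpleAffineRoot b), L.length = n ∧
      (L.map (simpleReflection b)).prod = w}.Nonempty := by
    obtain ⟨L, hL⟩ := exists_wordProd_eq b w
    exact ⟨_, L, rfl, hL⟩
  obtain ⟨L, hL, hw⟩ := Nat.sInf_mem hne
  have hw' : wordProd b L = w := hw
  rw [← hw'] at h
  obtain ⟨L', h1, h2⟩ := exists_shorter_word hγ L h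
  rw [hw'] at h2
  have h3 : length b (rootReflection P γ * w) ≤ L'.length := Nat.sInf_le ⟨L', rfl, h2⟩
  exact h3.trans_lt (h1.trans_eq hL)

theorem length_lt_of_not_isInversion {γ : AffineRoot P} (hγ : AffineRoot.IsPositive b γ)
    {w : affineWeylGroup P} (h : ¬ IsInversion b γ w) :
    length b w < length b (rootReflection P γ * w) := by
  have := length_lt_of_isInversion hγ (isInversion_rootReflection_mul_iff.mpr h)
  rwa [← mul_assoc, rootReflection_mul_self, one_mul] at this

theorem length_lt_of_bruhat_lt {x y : affineWeylGroup P} (h : (bruhatOrder b).lt x y) :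
    length b x < length b y := by
  obtain ⟨h1, h2⟩ := ((bruhatOrder b).lt_iff_le_not_ge x y).mp h
  refine (length_le_of_bruhat b h1).resolve_left ?_
  rintro rfl
  exact h2 h1

theorem AffineEdge.not_isInversion (e : AffineEdge b) : ¬ IsInversion b e.root e.source :=
  fun h => lt_asymm (length_lt_of_bruhat_lt e.lt) (length_lt_of_isInversion e.isPositive h)

theorem AffineEdge.target_ne_one (e : AffineEdge b) : e.target ≠ 1 := by
  intro h
  have h1 : length b e.source < length b (e.target) := length_lt_of_bruhat_lt e.lt
  have h2 : length b (1 : affineWeylGroup P) ≤ 0 := Nat.sInf_le ⟨[], rfl, rfl⟩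
  rw [h] at h1
  omega

theorem isReflection_conj_rootReflection (γ : AffineRoot P) (w : affineWeylGroup P) :
    IsReflection b (w⁻¹ * rootReflection P γ * w) := by
  obtain ⟨L, a, h⟩ := exists_word_rootReflection_eq b γ
  exact ⟨a, w⁻¹ * wordProd b L, by rw [h]; group⟩

theorem bruhat_lt_of_not_isInversion {γ : AffineRoot P} (hγ : AffineRoot.IsPositive b γ)
    {w : affineWeylGroup P} (h : ¬ IsInversion b γ w) :
    (bruhatOrder b).lt w (rootReflection P γ * w) := by
  have hl := length_lt_of_not_isInversion hγ h
  refine ((bruhatOrder b).lt_iff_le_not_ge _ _).mpr ⟨Relation.ReflTransGen.single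
    ⟨hl, _, isReflection_conj_rootReflection γ w, by group⟩, fun h' => ?_⟩
  rcases length_le_of_bruhat b h' with h' | h'
  · exact hl.ne (by rw [h'])
  · exact lt_asymm hl h'

/-- The edge starting at a given element with a given root. -/
def mkEdge {γ : AffineRoot P} (hγ : AffineRoot.IsPositive b γ)
    {w : affineWeylGroup P} (h : ¬ IsInversion b γ w) : AffineEdge b :=
  ⟨w, γ, hγ, bruhat_lt_of_not_isInversion hγ h⟩

theorem rootReflection_mul_of_toWeight_eq {γ : AffineRoot P} {x : affineWeylGroup P}
    {a : SimpleAffineRoot b} (h : AffineRoot.toWeight P γ = weightAct P x (simpleWeight b a)) :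
    rootReflection P γ * x = x * simpleReflection b a := by
  rw [rootReflection_of_toWeight_eq h, inv_mul_cancel_right]
  rfl

/-- The elements `x` and `x s`, for `s` a simple reflection, are joined by an edge. -/
theorem exists_edge_mul_simpleReflection (x : affineWeylGroup P) (a : SimpleAffineRoot b) :
    ∃ e : AffineEdge b, (e.source = x ∧ e.target = x * simpleReflection b a) ∨
      (e.source = x * simpleReflection b a ∧ e.target = x) := by
  obtain ⟨ε, hε, -⟩ := exists_toWeight_eq_weightAct x (SimpleAffineRoot.toRoot b a)
  obtain ⟨γ, hγ, h⟩ := exists_isPositive_rootReflection_eq b ε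
  have h1 : rootReflection P γ * x = x * simpleReflection b a := by
    rw [h, rootReflection_mul_of_toWeight_eq hε]
  by_cases h2 : IsInversion b γ x
  · have h3 : ¬ IsInversion b γ (x * simpleReflection b a) := by
      rw [← h1, isInversion_rootReflection_mul_iff, not_not]
      exact h2
    refine ⟨mkEdge hγ h3, Or.inr ⟨rfl, ?_⟩⟩
    change rootReflection P γ * (x * simpleReflection b a) = x
    rw [← h1, ← mul_assoc, rootReflection_mul_self, one_mul]
  · exact ⟨mkEdge hγ h2, Or.inl ⟨rfl, h1⟩⟩

/-- The reflections in the root of the edge and in the affine root xα coincide, and a reflection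
determines its root up to sign. -/
theorem AffineEdge.toWeight_root {e : AffineEdge b} {a : SimpleAffineRoot b}
    (h : e.target = e.source * simpleReflection b a) :
    AffineRoot.toWeight P e.root = weightAct P e.source (simpleWeight b a) ∨
      AffineRoot.toWeight P e.root = -weightAct P e.source (simpleWeight b a) := by
  obtain ⟨ε, hε, -⟩ := exists_toWeight_eq_weightAct e.source (SimpleAffineRoot.toRoot b a)
  have h1 := rootReflection_mul_of_toWeight_eq hε
  rw [← h, AffineEdge.target, mul_left_inj] at h1
  rw [← hε, ← toWeight_opp]
  rcases eq_or_eq_opp_of_rootReflection_eq h1.symm with h2 | h2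
  · exact Or.inl (by rw [h2])
  · exact Or.inr (by rw [h2])

/-- The translate by a simple reflection `s` of an edge that does not join `x` and `x s`. -/
theorem AffineEdge.exists_mul_simpleReflection {e : AffineEdge b} {a : SimpleAffineRoot b}
    (h : e.target ≠ e.source * simpleReflection b a) :
    ∃ e' : AffineEdge b, e'.root = e.root ∧ e'.source = e.source * simpleReflection b a ∧
      e'.target = e.target * simpleReflection b a := by
  -- An inversion of xs in the root of an edge starting at x would either be one of x, impossible at
  -- the start of an edge, or mean that the edge joins x and xs.
  have h1 : ¬ IsInversion b e.root (e.source * simpleReflection b a) := fun h' =>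
    (isInversion_mul_simpleReflection h').elim e.not_isInversion h
  exact ⟨mkEdge e.isPositive h1, rfl, rfl, (mul_assoc _ _ _).symm⟩

theorem weightAct_simpleReflection_mul (x : affineWeylGroup P) (a : SimpleAffineRoot b) :
    weightAct P (x * simpleReflection b a) (simpleWeight b a) =
      -weightAct P x (simpleWeight b a) := by
  rw [weightAct_mul, simpleReflection, weightAct_rootReflection_self, weightAct_neg]

theorem AffineEdge.exists_weightAct_target (e : AffineEdge b) (β : AffineWeight P) :
    ∃ c : ℤ, weightAct P e.target β =
      weightAct P e.source β - c • AffineRoot.toWeight P e.root := by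
  rw [AffineEdge.target, weightAct_mul]
  exact exists_weightAct_rootReflection _ _

end BruhatEdges

/-! ### Closure properties of the set J(s) -/

section Subsequences

variable {F : Type u} [Field F] [NeZero (2 : F)]
variable {ι V N : Type v} [Finite ι] [AddCommGroup V] [Module ℚ V] [AddCommGroup N] [Module ℚ N]
variable {P : RootPairing ι ℚ V N} [P.IsCrystallographic] [P.IsRootSystem] [P.IsReduced]
  [P.IsIrreducible] {b : P.Base}

theorem ev_snoc {l : ℕ} (s : Fin (l + 1) → SimpleAffineRoot b) (σ : Subseq l) (t : Bool) :
    ev s (Fin.snoc σ t : Subseq (l + 1)) = ev (Fin.init s) σ *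
      if t then simpleReflection b (s (Fin.last l)) else 1 := by
  rw [ev_succ, Fin.init_snoc, Fin.snoc_last]

theorem mem_J_of_mem_J_init {l : ℕ} {s : Fin (l + 1) → SimpleAffineRoot b}
    {x : affineWeylGroup P} (h : x ∈ J (Fin.init s)) : x ∈ J s := by
  obtain ⟨σ, rfl⟩ := h
  exact ⟨Fin.snoc σ false, by simp [ev_snoc]⟩

theorem mul_mem_J_of_mem_J_init {l : ℕ} {s : Fin (l + 1) → SimpleAffineRoot b}
    {x : affineWeylGroup P} (h : x ∈ J (Fin.init s)) :
    x * simpleReflection b (s (Fin.last l)) ∈ J s := by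
  obtain ⟨σ, rfl⟩ := h
  exact ⟨Fin.snoc σ true, by simp [ev_snoc]⟩

theorem mem_J_cases {l : ℕ} {s : Fin (l + 1) → SimpleAffineRoot b}
    {x : affineWeylGroup P} (h : x ∈ J s) : x ∈ J (Fin.init s) ∨
      ∃ y ∈ J (Fin.init s), x = y * simpleReflection b (s (Fin.last l)) := by
  obtain ⟨σ, rfl⟩ := h
  rw [ev_succ]
  split_ifs
  · exact Or.inr ⟨_, ⟨_, rfl⟩, rfl⟩
  · exact Or.inl ⟨_, (mul_one _).symm⟩

theorem mul_mem_J {l : ℕ} {s : Fin (l + 1) → SimpleAffineRoot b}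
    {x : affineWeylGroup P} (h : x ∈ J s) : x * simpleReflection b (s (Fin.last l)) ∈ J s := by
  rcases mem_J_cases h with h | ⟨y, hy, rfl⟩
  · exact mul_mem_J_of_mem_J_init h
  · rw [mul_assoc, simpleReflection, rootReflection_mul_self, mul_one]
    exact mem_J_of_mem_J_init hy

/-- The exchange argument again, now tracking subsequences of s: multiplying by s_γ on the left
turns one used entry into a blank, so the product stays in J(s). The subsequence need not be a
reduced word. -/
theorem rootReflection_mul_mem_J {γ : AffineRoot P} (hγ : AffineRoot.IsPositive b γ) :
    ∀ {l : ℕ} {s : Fin l → SimpleAffineRoot b} {x : affineWeylGroup P}, x ∈ J s →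
      IsInversion b γ x → rootReflection P γ * x ∈ J s
  | 0, s, x, hx, h => by
    obtain ⟨σ, rfl⟩ := hx
    have h1 : ev s σ = 1 := by simp [ev]
    exact absurd (h1 ▸ h) (not_isInversion_one hγ)
  | l + 1, s, x, hx, h => by
    rcases mem_J_cases hx with hx | ⟨y, hy, rfl⟩
    · exact mem_J_of_mem_J_init (rootReflection_mul_mem_J hγ hx h)
    · rcases isInversion_mul_simpleReflection h with h | h
      · rw [← mul_assoc]
        exact mul_mem_J_of_mem_J_init (rootReflection_mul_mem_J hγ hy h)
      · rw [← mul_assoc, h, mul_assoc, simpleReflection, rootReflection_mul_self, mul_one]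
        exact mem_J_of_mem_J_init hy

/-- The set `J(s)` contains the start of each edge whose end it contains. -/
theorem AffineEdge.source_mem_J {e : AffineEdge b} {l : ℕ} {s : Fin l → SimpleAffineRoot b}
    (h : e.target ∈ J s) : e.source ∈ J s := by
  have h1 := rootReflection_mul_mem_J e.isPositive h
    (isInversion_rootReflection_mul_iff.mpr e.not_isInversion)
  rwa [AffineEdge.target, ← mul_assoc, rootReflection_mul_self, one_mul] at h1

end Subsequences

/-! ### Divisibility by linear forms in the symmetric algebra -/

section LinearForms

variable {F : Type u} [Field F] {E : Type v} [AddCommGroup E] [Module F E]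

theorem SymmetricAlgebra.ι_ne_zero {β : E} (hβ : β ≠ 0) : SymmetricAlgebra.ι F E β ≠ 0 := by
  intro h
  refine hβ ((Module.forall_dual_apply_eq_zero_iff F β).mp fun f => ?_)
  rw [← SymmetricAlgebra.lift_ι_apply f β, h, map_zero]

/-- A linear form divides a product of a linear form not proportional to it and an element `f` of
the symmetric algebra only if it divides `f`. -/
theorem SymmetricAlgebra.ι_dvd_of_ι_mul_eq {β γ : E} (hγ : γ ≠ 0) (h : ∀ c : F, c • γ ≠ β)
    {f g : SymmetricAlgebra F E}
    (hfg : SymmetricAlgebra.ι F E β * f = SymmetricAlgebra.ι F E γ * g) :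
    SymmetricAlgebra.ι F E γ ∣ f := by
  -- Completing γ, β to a basis turns S into a polynomial ring in which they are distinct variables;
  -- the variable of γ is prime and does not divide that of β.
  have hli : LinearIndependent F ![γ, β] := (LinearIndependent.pair_iff' hγ).mpr h
  have hli' := hli.linearIndepOn_id
  let B := Module.Basis.extend hli'
  have hmem (k : Fin 2) : ![γ, β] k ∈ hli'.extend (Set.subset_univ _) :=
    hli'.subset_extend _ (Set.mem_range_self k)
  let e := SymmetricAlgebra.equivMvPolynomial B
  have he (k : Fin 2) : e (SymmetricAlgebra.ι F E (![γ, β] k)) = MvPolynomial.X ⟨_, hmem k⟩ := by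
    have h1 := SymmetricAlgebra.equivMvPolynomial_ι_apply B ⟨_, hmem k⟩
    rwa [Module.Basis.extend_apply_self] at h1
  have e0 := he 0
  have e1 := he 1
  simp only [Matrix.cons_val_zero, Matrix.cons_val_one] at e0 e1
  have h2 := congrArg e hfg
  rw [map_mul, map_mul, e0, e1] at h2
  have h3 := (MvPolynomial.X_prime.dvd_or_dvd (Dvd.intro _ h2.symm)).resolve_left fun h4 => by
    have := congrArg Subtype.val (MvPolynomial.X_dvd_X.mp h4)
    exact h 1 (by simpa using this)
  rw [← e0] at h3
  exact (map_dvd_iff e).mp h3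

end LinearForms

/-! ### Sheaves to which translation can be applied -/

section SheafConditions

variable {F : Type u} [Field F] {VF : Type (max u v)} [AddCommGroup VF] [Module F VF]
variable {G : LabelledGraph.{u, v} F VF}

/-- The conditions on a sheaf that are preserved by translation: it is supported on `J`, its stalks
are torsion free and reflexive with respect to linear forms, the stalk at the end of an edge
modulo the label of the edge is the module at the edge, and the global sections surject onto all
the stalks. -/
structure Sheaf.IsTranslatable (M : Sheaf G) (J : Set G.V) : Prop where
  supported : M.SupportedOn J
  torsionFree : ∀ (x : G.V) (β : VF), β ≠ 0 → ∀ m : M.stalk x,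
    SymmetricAlgebra.ι F VF β • m = 0 → m = 0
  regular : ∀ (x : G.V) (β γ : VF), γ ≠ 0 → (∀ c : F, c • γ ≠ β) → ∀ m m' : M.stalk x,
    SymmetricAlgebra.ι F VF β • m = SymmetricAlgebra.ι F VF γ • m' →
      ∃ n, m = SymmetricAlgebra.ι F VF γ • n
  surjective : ∀ e, Function.Surjective (M.resTgt e)
  ker_resTgt : ∀ e m, M.resTgt e m = 0 → ∃ n, m = G.slabel e • n
  exists_section : ∀ (x : G.V) (m : M.stalk x), ∃ g : M.globalSections, g.1 x = m

namespace Sheaf.IsTranslatable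

variable {M : Sheaf G} {J : Set G.V} (hM : M.IsTranslatable J)
include hM

/-- Lift m to n in the stalk at the end of the edge. Then βn is divisible by the label, and since β
is not proportional to the label, regularity makes n itself divisible by it; so n dies on the edge.
-/
theorem edge_eq_zero_of_smul_eq_zero {e : G.E} {β : VF} (hβ : ∀ c : F, c • G.label e ≠ β)
    {m : M.edge e} (hm : SymmetricAlgebra.ι F VF β • m = 0) : m = 0 := by
  obtain ⟨n, rfl⟩ := hM.surjective e m
  rw [← map_smul] at hm
  obtain ⟨n', hn'⟩ := hM.ker_resTgt e _ hm
  obtain ⟨k, rfl⟩ := hM.regular _ _ _ (G.label_ne_zero e) hβ _ _ hn'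
  rw [map_smul, M.label_smul]

theorem edge_eq_zero_of_notMem {e : G.E} (he : G.tgt e ∉ J) (m : M.edge e) : m = 0 := by
  obtain ⟨n, rfl⟩ := hM.surjective e m
  rw [hM.supported _ he n, map_zero]

/-- A family of elements of the stalks is a section if suitable multiples of it are. -/
theorem mem_sectionsOn_of_smul {I : Set G.V} {n : ∀ x : I, M.stalk x}
    (h : ∀ (e : G.E) (hs : G.src e ∈ I) (ht : G.tgt e ∈ I), ∃ β : VF,
      (∀ c : F, c • G.label e ≠ β) ∧
        M.resSrc e (SymmetricAlgebra.ι F VF β • n ⟨_, hs⟩) =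
          M.resTgt e (SymmetricAlgebra.ι F VF β • n ⟨_, ht⟩)) :
    n ∈ M.sectionsOn I := by
  intro e hs ht
  obtain ⟨β, hβ, h⟩ := h e hs ht
  rw [map_smul, map_smul, ← sub_eq_zero, ← smul_sub] at h
  exact sub_eq_zero.mp (hM.edge_eq_zero_of_smul_eq_zero hβ h)

theorem sectionsOn_torsionFree {I : Set G.V} {β : VF} (hβ : β ≠ 0) {m : M.sectionsOn I}
    (hm : SymmetricAlgebra.ι F VF β • m = 0) : m = 0 :=
  Subtype.ext (funext fun x => hM.torsionFree _ _ hβ _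
    (congrFun (congrArg Subtype.val hm) x))

theorem sectionsOn_regular {I : Set G.V} {β γ : VF} (hγ : γ ≠ 0) (hβγ : ∀ c : F, c • γ ≠ β)
    {m m' : M.sectionsOn I}
    (hm : SymmetricAlgebra.ι F VF β • m = SymmetricAlgebra.ι F VF γ • m') :
    ∃ n : M.sectionsOn I, m = SymmetricAlgebra.ι F VF γ • n := by
  have hx (x : I) : SymmetricAlgebra.ι F VF β • m.1 x = SymmetricAlgebra.ι F VF γ • m'.1 x :=
    congrFun (congrArg Subtype.val hm) x
  choose n hn using fun x : I => hM.regular _ _ _ hγ hβγ _ _ (hx x)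
  have hn' (x : I) : m'.1 x = SymmetricAlgebra.ι F VF β • n x := by
    refine sub_eq_zero.mp (hM.torsionFree _ _ hγ _ ?_)
    rw [smul_sub, ← hx x, hn x, smul_comm, sub_self]
  refine ⟨⟨n, hM.mem_sectionsOn_of_smul fun e hs ht => ?_⟩, Subtype.ext (funext hn)⟩
  -- The stalkwise quotients satisfy γn = m and βn = m', and m and m' are sections. The label of an
  -- edge cannot be proportional to both γ and β, so one of the two factors can be cancelled in the
  -- edge module.
  by_cases h : ∀ c : F, c • G.label e ≠ γ
  · refine ⟨γ, h, ?_⟩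
    rw [← hn, ← hn]
    exact m.2 e hs ht
  · push Not at h
    obtain ⟨c, rfl⟩ := h
    refine ⟨β, fun d hd => ?_, ?_⟩
    · have hc : c ≠ 0 := by rintro rfl; simp at hγ
      exact hβγ (d * c⁻¹) (by rw [smul_smul, inv_mul_cancel_right₀ hc, hd])
    · rw [← hn', ← hn']
      exact m'.2 e hs ht

end Sheaf.IsTranslatable

/-- The product of a global section with a family of elements of `S` which satisfies the congruences
of the structure algebra. -/
def Sheaf.mulSection {M : Sheaf G} (f : G.V → SymmetricAlgebra F VF)
    (hf : ∀ e, f (G.src e) - f (G.tgt e) ∈ Ideal.span {G.slabel e}) (g : M.globalSections) :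
    M.globalSections :=
  ⟨fun x => f x • g.1 x, fun e => by
    rw [map_smul, map_smul, ← g.2 e, ← sub_eq_zero, ← sub_smul]
    obtain ⟨c, hc⟩ := Ideal.mem_span_singleton'.mp (hf e)
    rw [← hc, mul_smul, M.label_smul, smul_zero]⟩

/-- The restriction of a global section to a set of vertices. -/
def Sheaf.restrictSection {M : Sheaf G} (I : Set G.V) (g : M.globalSections) : M.sectionsOn I :=
  ⟨fun x => g.1 x, fun e _ _ => g.2 e⟩

end SheafConditions

/-! ### The functions c^β and the inverse of 2 -/

section WeightFunctions

variable {F : Type u} [Field F]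
variable {ι V N : Type v} [AddCommGroup V] [Module ℚ V] [AddCommGroup N] [Module ℚ N]
variable {P : RootPairing ι ℚ V N}

theorem reduceWeight_neg (β : AffineWeight P) : reduceWeight F (-β) = -reduceWeight F β :=
  TensorProduct.tmul_neg _ _

theorem reduceWeight_sub_zsmul (β γ : AffineWeight P) (c : ℤ) :
    reduceWeight F (β - c • γ) = reduceWeight F β - (c : F) • reduceWeight F γ := by
  rw [reduceWeight, TensorProduct.tmul_sub, ← TensorProduct.smul_tmul, reduceWeight, reduceWeight,
    TensorProduct.smul_tmul']
  simp

variable [Finite ι] [P.IsCrystallographic] [P.IsRootSystem] [P.IsReduced]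
  [P.IsIrreducible] {b : P.Base} [NeZero (2 : F)]

/-- A reflection s_γ changes a weight by an integral multiple of γ. This is why multiplication by
c^β preserves sections. -/
theorem weightFunction_sub_mem (β : AffineWeight P) (e : AffineEdge b) :
    weightFunction F β e.source - weightFunction F β e.target ∈
      Ideal.span {(affineGraph F b).slabel e} := by
  obtain ⟨c, hc⟩ := e.exists_weightAct_target β
  rw [weightFunction, weightFunction, hc, reduceWeight_sub_zsmul, map_sub, map_smul, sub_sub_cancel,
    Algebra.smul_def]
  exact Ideal.mul_mem_left _ _ (Ideal.mem_span_singleton_self _)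

theorem weightFunction_mul_simpleReflection (a : SimpleAffineRoot b) (x : affineWeylGroup P) :
    weightFunction F (simpleWeight b a) (x * simpleReflection b a) =
      -weightFunction F (simpleWeight b a) x := by
  rw [weightFunction, weightAct_simpleReflection_mul, reduceWeight_neg, map_neg, weightFunction]

theorem weightFunction_eq_slabel {a : SimpleAffineRoot b} {e : AffineEdge b}
    (h : e.target = e.source * simpleReflection b a) :
    weightFunction F (simpleWeight b a) e.source = (affineGraph F b).slabel e ∨
      weightFunction F (simpleWeight b a) e.source = -(affineGraph F b).slabel e := by
  rcases AffineEdge.toWeight_root h with h | h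
  · left
    rw [weightFunction, ← h]
  · right
    rw [weightFunction, ← neg_eq_iff_eq_neg, ← map_neg, ← reduceWeight_neg, ← h]

variable (F P) in
/-- One half, as an element of the symmetric algebra. -/
def half : SymAlg F P := algebraMap F _ 2⁻¹

theorem half_add_half : half F P + half F P = 1 := by
  rw [half, ← map_add, ← two_mul, mul_inv_cancel₀ (NeZero.ne _), map_one]

theorem half_smul_add_half_smul {A : Type*} [AddCommGroup A] [Module (SymAlg F P) A] (x : A) :
    half F P • x + half F P • x = x := by
  rw [← add_smul, half_add_half, one_smul]

end WeightFunctions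

/-! ### Cosets {x, xs} as pairs of ends of edges -/

section Cosets

variable {ι V N : Type v} [Finite ι] [AddCommGroup V] [Module ℚ V] [AddCommGroup N] [Module ℚ N]
variable {P : RootPairing ι ℚ V N} [P.IsCrystallographic] [P.IsRootSystem] [P.IsReduced]
  [P.IsIrreducible] {b : P.Base}

/-- The subgroup `{1, s}` for the simple reflection `s` of a simple affine root. -/
abbrev simpleSubgroup (a : SimpleAffineRoot b) : Subgroup (affineWeylGroup P) :=
  Subgroup.closure {simpleReflection b a}

theorem mul_simpleReflection_cancel (x : affineWeylGroup P) (a : SimpleAffineRoot b) :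
    x * simpleReflection b a * simpleReflection b a = x := by
  rw [mul_assoc, simpleReflection, rootReflection_mul_self, mul_one]

theorem coset_mul_simpleReflection (x : affineWeylGroup P) (a : SimpleAffineRoot b) :
    ((x * simpleReflection b a : affineWeylGroup P) : affineWeylGroup P ⧸ simpleSubgroup a) = x :=
  QuotientGroup.mk_mul_of_mem x (Subgroup.subset_closure rfl)

theorem coset_eq_iff {a : SimpleAffineRoot b} {x y : affineWeylGroup P} :
    (y : affineWeylGroup P ⧸ simpleSubgroup a) = x ↔ y = x ∨ y = x * simpleReflection b a := by
  constructor
  · intro h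
    have key : ∀ t ∈ simpleSubgroup a, t = 1 ∨ t = simpleReflection b a := by
      intro t ht
      induction ht using Subgroup.closure_induction with
      | mem t ht => exact Or.inr ht
      | one => exact Or.inl rfl
      | mul t t' _ _ h h' =>
        rcases h with rfl | rfl <;> rcases h' with rfl | rfl <;>
          simp [simpleReflection, rootReflection_mul_self]
      | inv t _ h =>
        rcases h with rfl | rfl
        · simp
        · exact Or.inr (rootReflection_inv _)
    rcases key _ (QuotientGroup.eq.mp h.symm) with h | h
    · exact Or.inl (inv_mul_eq_one.mp h).symm
    · exact Or.inr (inv_mul_eq_iff_eq_mul.mp h)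
  · rintro (rfl | rfl)
    · rfl
    · exact coset_mul_simpleReflection x a

theorem AffineEdge.source_ne_target (e : AffineEdge b) : e.source ≠ e.target := by
  intro h
  have h1 : length b e.source < length b (e.target) := length_lt_of_bruhat_lt e.lt
  rw [← h] at h1
  exact lt_irrefl _ h1

theorem AffineEdge.coset_eq_iff {a : SimpleAffineRoot b} (e : AffineEdge b) :
    (e.source : affineWeylGroup P ⧸ simpleSubgroup a) = e.target ↔
      e.target = e.source * simpleReflection b a := by
  rw [eq_comm, BottSamelson.coset_eq_iff]
  exact or_iff_right e.source_ne_target.symm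

/-- Every coset is the set of the two ends of an edge. -/
theorem exists_edge_of_coset {a : SimpleAffineRoot b}
    (c : affineWeylGroup P ⧸ simpleSubgroup a) :
    ∃ e : AffineEdge b, (e.source : affineWeylGroup P ⧸ simpleSubgroup a) = c ∧
      e.target = e.source * simpleReflection b a := by
  obtain ⟨x, rfl⟩ := QuotientGroup.mk_surjective c
  obtain ⟨e, ⟨h1, h2⟩ | ⟨h1, h2⟩⟩ := exists_edge_mul_simpleReflection x a
  · exact ⟨e, by rw [h1], by rw [h2, h1]⟩
  · exact ⟨e, by rw [h1, coset_mul_simpleReflection], by rw [h2, h1, mul_simpleReflection_cancel]⟩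

end Cosets

/-! ### Extension of sections from cosets and compatibility in translated sheaves -/

section Translation

variable {F : Type u} [Field F] [NeZero (2 : F)]
variable {ι V N : Type v} [Finite ι] [AddCommGroup V] [Module ℚ V] [AddCommGroup N] [Module ℚ N]
variable {P : RootPairing ι ℚ V N} [P.IsCrystallographic] [P.IsRootSystem] [P.IsReduced]
  [P.IsIrreducible] {b : P.Base}

/-- The global sections of a translatable sheaf surject onto the sections over `{x, xs}`. -/
theorem Sheaf.IsTranslatable.exists_section_coset {M : Sheaf (affineGraph F b)}
    {I : Set (affineWeylGroup P)} (hM : M.IsTranslatable I) {a : SimpleAffineRoot b}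
    (c : affineWeylGroup P ⧸ simpleSubgroup a) (n : OnStalk M c) :
    ∃ g : M.globalSections, Sheaf.restrictSection (cosetFibre _ c) g = n := by
  obtain ⟨e, rfl, he⟩ := exists_edge_of_coset c
  have hs : e.source ∈ cosetFibre (simpleSubgroup a)
    (e.source : affineWeylGroup P ⧸ simpleSubgroup a) := rfl
  have ht : e.target ∈ cosetFibre (simpleSubgroup a)
    (e.source : affineWeylGroup P ⧸ simpleSubgroup a) := (e.coset_eq_iff.mpr he).symm
  obtain ⟨g₁, h₁⟩ := hM.exists_section e.source (n.1 ⟨_, hs⟩)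
  -- The global section g₁ has the right value at the lower vertex. Its error at the upper one
  -- vanishes on the edge, so it is the label times some k.
  have h2 : M.resTgt e (n.1 ⟨_, ht⟩ - g₁.1 e.target) = 0 := by
    have h3 := n.2 e hs ht
    have h4 := g₁.2 e
    rw [map_sub, ← h3]
    erw [← h4]
    erw [h₁]
    exact sub_self _
  obtain ⟨k, hk⟩ := hM.ker_resTgt e _ h2
  obtain ⟨g₂, h₂⟩ := hM.exists_section e.target k
  let α := weightFunction F (simpleWeight b a)
  have hα : α e.target = -α e.source := by
    simp only [α, he, weightFunction_mul_simpleReflection]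
  -- The correction must vanish at the lower vertex x and equal label · k at the upper vertex xs.
  -- The function c^α - xα vanishes at x and equals -2xα at xs, where xα is ± the label; hence the
  -- factors `half` and ε.
  let g₃ : M.globalSections := Sheaf.mulSection
    (fun x => α x - α e.source) (fun e => by
      rw [sub_sub_sub_cancel_right]; exact weightFunction_sub_mem _ e) g₂
  have h30 : g₃.1 e.source = 0 := by simp [g₃, Sheaf.mulSection]
  have h31 : half F P • g₃.1 e.target = -α e.source • k := by
    change half F P • ((α e.target - α e.source) • g₂.1 e.target) = _
    rw [h₂, hα, sub_smul, smul_sub, neg_smul, smul_neg, ← neg_add', half_smul_add_half_smul]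
  obtain ⟨ε, hε⟩ : ∃ ε : SymAlg F P, ε • -α e.source • k = (affineGraph F b).slabel e • k := by
    rcases weightFunction_eq_slabel (F := F) he with h | h
    · exact ⟨-1, by simp [α, h]⟩
    · exact ⟨1, by simp [α, h]⟩
  refine ⟨g₁ + ε • half F P • g₃, Subtype.ext (funext fun y => ?_)⟩
  obtain ⟨y, hy⟩ := y
  change g₁.1 y + ε • half F P • g₃.1 y = n.1 ⟨y, hy⟩
  rcases coset_eq_iff.mp (show (y : affineWeylGroup P ⧸ simpleSubgroup a) = e.source from hy)
    with h | h
  · subst h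
    rw [h30, h₁, smul_zero, smul_zero, add_zero]
  · rw [← he] at h
    subst h
    rw [h31, hε]
    erw [← hk]
    exact add_sub_cancel _ _

/-- Any section over the source coset extends to a global section, which has the same values on the
edges when restricted from the target coset. Hence the default value `0` in `thetaOn` never occurs
for translatable sheaves. -/
theorem Sheaf.IsTranslatable.range_onSrc_le {M : Sheaf (affineGraph F b)}
    {I : Set (affineWeylGroup P)} (hM : M.IsTranslatable I) {a : SimpleAffineRoot b}
    (e : QuotientEdge b (simpleSubgroup a)) :
    LinearMap.range (onSrc M e) ≤ LinearMap.range (onTgt M e) := by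
  rintro _ ⟨n, rfl⟩
  obtain ⟨g, rfl⟩ := hM.exists_section_coset e.source n
  exact ⟨Sheaf.restrictSection _ g, funext fun e' => (g.2 e'.1).symm⟩

/-- The component at `y` of an element of the stalk of `ϑ^s M` at `x`, for `y` in `{x, xs}`. -/
def thetaProj (M : Sheaf (affineGraph F b)) {a : SimpleAffineRoot b} (x y : affineWeylGroup P)
    (h : (y : affineWeylGroup P ⧸ simpleSubgroup a) = x) :
    (theta a M).stalk x →ₗ[SymAlg F P] M.stalk y :=
  LinearMap.proj (⟨y, h⟩ : cosetFibre (simpleSubgroup a)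
    (x : affineWeylGroup P ⧸ simpleSubgroup a)) ∘ₗ Submodule.subtype _

theorem outDatum_inner_iff {H : Subgroup (affineWeylGroup P)} (M : Sheaf (quotientGraph F b H))
    (e : AffineEdge b) (h : (e.source : affineWeylGroup P ⧸ H) = e.target)
    (p : M.stalk e.source) (q : M.stalk e.target) :
    (outDatum M e).fromSrc p = (outDatum M e).fromTgt q ↔
      ∃ k, p - stalkCast M h.symm q = (affineGraph F b).slabel e • k := by
  have h1 : outDatum M e = outInner M e h := dif_pos h
  rw [h1]
  change Submodule.mkQ _ p = Submodule.mkQ _ (stalkCast M h.symm q) ↔ _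
  rw [Submodule.mkQ_apply, Submodule.mkQ_apply, Submodule.Quotient.eq,
    Submodule.ideal_span_singleton_smul, Submodule.mem_smul_pointwise_iff_exists]
  exact ⟨fun ⟨k, _, hk⟩ => ⟨k, hk.symm⟩, fun ⟨k, hk⟩ => ⟨k, trivial, hk.symm⟩⟩

theorem outDatum_outer_iff {H : Subgroup (affineWeylGroup P)} (M : Sheaf (quotientGraph F b H))
    (e : AffineEdge b) (h : (e.source : affineWeylGroup P ⧸ H) ≠ e.target)
    (p : M.stalk e.source) (q : M.stalk e.target) :
    (outDatum M e).fromSrc p = (outDatum M e).fromTgt q ↔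
      M.resSrc (quotientEdgeOf e h) p = M.resTgt (quotientEdgeOf e h) q := by
  have h1 : outDatum M e = outOuter M e h := dif_neg h
  rw [h1]
  rfl

theorem stalkCast_thetaOn {H : Subgroup (affineWeylGroup P)} (M : Sheaf (affineGraph F b))
    {c c' : affineWeylGroup P ⧸ H} (h : c = c') (n : OnStalk M c) (y : affineWeylGroup P)
    (hy : y ∈ cosetFibre H c') :
    (stalkCast (thetaOn H M) h n : OnStalk M c').1 ⟨y, hy⟩ = n.1 ⟨y, h ▸ hy⟩ := by
  subst h
  rfl

theorem thetaOn_res_eq_iff {H : Subgroup (affineWeylGroup P)} (M : Sheaf (affineGraph F b))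
    (e : QuotientEdge b H) (h : LinearMap.range (onSrc M e) ≤ LinearMap.range (onTgt M e))
    (p : OnStalk M e.source) (q : OnStalk M e.target) :
    (thetaOn H M).resSrc e p = (thetaOn H M).resTgt e q ↔
      ∀ e' : EdgesOver e, M.resSrc e'.1 (p.1 ⟨e'.1.source, e'.2.1⟩) =
        M.resTgt e'.1 (q.1 ⟨e'.1.target, e'.2.2.1⟩) := by
  have h1 : (thetaOn H M).resSrc e =
      (onSrc M e).codRestrict _ fun m => h (LinearMap.mem_range_self _ m) := dif_pos h
  rw [h1]
  change (⟨onSrc M e p, _⟩ : LinearMap.range (onTgt M e)) = ⟨onTgt M e q, _⟩ ↔ _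
  rw [Subtype.mk.injEq, funext_iff]
  rfl

end Translation

/-! ### Global sections of a translated sheaf -/

section Translation

variable {F : Type u} [Field F] [NeZero (2 : F)]
variable {ι V N : Type v} [Finite ι] [AddCommGroup V] [Module ℚ V] [AddCommGroup N] [Module ℚ N]
variable {P : RootPairing ι ℚ V N} [P.IsCrystallographic] [P.IsRootSystem] [P.IsReduced]
  [P.IsIrreducible] {b : P.Base}

/-- Rewrites the two kinds of edges in terms of M alone. The quotient k at an edge between x and xs
has to be a section over the coset, not merely a family of stalk elements, because the congruence is
taken in the stalk of ϑ_on M. -/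
theorem mem_globalSections_theta_iff {M : Sheaf (affineGraph F b)} {a : SimpleAffineRoot b}
    (hC : ∀ e : QuotientEdge b (simpleSubgroup a),
      LinearMap.range (onSrc M e) ≤ LinearMap.range (onTgt M e))
    (m : ∀ x, (theta a M).stalk x) :
    m ∈ (theta a M).globalSections ↔
      (∀ (e : AffineEdge b) (h : e.target = e.source * simpleReflection b a),
        ∃ k : OnStalk M (e.source : affineWeylGroup P ⧸ simpleSubgroup a),
          ∀ (y : affineWeylGroup P)
            (hy : (y : affineWeylGroup P ⧸ simpleSubgroup a) = e.source),
            thetaProj M e.source y hy (m e.source) -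
              thetaProj M e.target y (hy.trans (e.coset_eq_iff.mpr h)) (m e.target) =
            (affineGraph F b).slabel e • k.1 ⟨y, hy⟩) ∧
      (∀ e : AffineEdge b, e.target ≠ e.source * simpleReflection b a →
        ∀ (e' : AffineEdge b)
          (hs : (e'.source : affineWeylGroup P ⧸ simpleSubgroup a) = e.source)
          (ht : (e'.target : affineWeylGroup P ⧸ simpleSubgroup a) = e.target),
          e'.root = e.root →
          M.resSrc e' (thetaProj M e.source e'.source hs (m e.source)) =
            M.resTgt e' (thetaProj M e.target e'.target ht (m e.target))) := by
  constructor
  · intro hm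
    refine ⟨fun e h => ?_, fun e h e' hs ht hr => ?_⟩
    · have h' : (e.source : affineWeylGroup P ⧸ simpleSubgroup a) = e.target :=
        e.coset_eq_iff.mpr h
      obtain ⟨k, hk⟩ := (outDatum_inner_iff (thetaOn _ M) e h' _ _).mp (hm e)
      refine ⟨k, fun y hy => ?_⟩
      have h1 := congrFun (congrArg Subtype.val hk) ⟨y, hy⟩
      have h2 := stalkCast_thetaOn M h'.symm (m e.target) y hy
      refine Eq.trans ?_ h1
      exact congrArg (fun t => thetaProj M e.source y hy (m e.source) - t) h2.symm
    · have h' : (e.source : affineWeylGroup P ⧸ simpleSubgroup a) ≠ e.target :=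
        fun h' => h (e.coset_eq_iff.mp h')
      exact (thetaOn_res_eq_iff M (quotientEdgeOf e h') (hC _) _ _).mp
        ((outDatum_outer_iff (thetaOn _ M) e h' _ _).mp (hm e)) ⟨e', hs, ht, hr⟩
  · rintro ⟨h1, h2⟩ e
    by_cases h : (e.source : affineWeylGroup P ⧸ simpleSubgroup a) = e.target
    · obtain ⟨k, hk⟩ := h1 e (e.coset_eq_iff.mp h)
      refine (outDatum_inner_iff (thetaOn _ M) e h _ _).mpr ⟨k, Subtype.ext (funext ?_)⟩
      rintro ⟨y, hy⟩
      have h2 := stalkCast_thetaOn M h.symm (m e.target) y hy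
      refine Eq.trans ?_ (hk y hy)
      exact congrArg (fun t => thetaProj M e.source y hy (m e.source) - t) h2
    · refine (outDatum_outer_iff (thetaOn _ M) e h _ _).mpr
        ((thetaOn_res_eq_iff M (quotientEdgeOf e h) (hC _) _ _).mpr ?_)
      rintro ⟨e', hs, ht, hr⟩
      exact h2 e (fun h' => h (e.coset_eq_iff.mpr h')) e' hs ht hr

theorem thetaProj_congr {M : Sheaf (affineGraph F b)} {a : SimpleAffineRoot b}
    (m : ∀ x, (theta a M).stalk x) {x x' y : affineWeylGroup P} (hx : x = x')
    (h : (y : affineWeylGroup P ⧸ simpleSubgroup a) = x)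
    (h' : (y : affineWeylGroup P ⧸ simpleSubgroup a) = x') :
    thetaProj M x y h (m x) = thetaProj M x' y h' (m x') := by
  subst hx
  rfl

/-- The elements of the stalk of `ϑ^s M` at `x` are sections over `{x, xs}`. -/
theorem thetaProj_section {M : Sheaf (affineGraph F b)} {a : SimpleAffineRoot b}
    {x : affineWeylGroup P} (m : (theta a M).stalk x) (e : AffineEdge b)
    (hs : (e.source : affineWeylGroup P ⧸ simpleSubgroup a) = x)
    (ht : (e.target : affineWeylGroup P ⧸ simpleSubgroup a) = x) :
    M.resSrc e (thetaProj M x e.source hs m) = M.resTgt e (thetaProj M x e.target ht m) :=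
  Subtype.property (p := (· ∈ M.sectionsOn (cosetFibre (simpleSubgroup a)
    (x : affineWeylGroup P ⧸ simpleSubgroup a)))) m e hs ht

theorem reduceWeight_weightAct_ne_zero (a : SimpleAffineRoot b) (x : affineWeylGroup P) :
    reduceWeight F (weightAct P x (simpleWeight b a)) ≠ 0 := by
  obtain ⟨γ, h, -⟩ := exists_toWeight_eq_weightAct x (SimpleAffineRoot.toRoot b a)
  rw [← h]
  exact reduceWeight_root_ne_zero F γ

/-- The hypotheses on a set of vertices under which the translation functor of a simple reflection
is controlled. -/
structure IsTranslationDomain (F : Type u) [Field F] [NeZero (2 : F)] (b : P.Base)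
    (I : Set (affineWeylGroup P)) (a : SimpleAffineRoot b) : Prop where
  source_mem : ∀ e : AffineEdge b, e.target ∈ I → e.source ∈ I
  mul_mem : ∀ x ∈ I, x * simpleReflection b a ∈ I
  gkm : (affineGraph F b).IsGKMOn I

namespace IsTranslationDomain

variable {I : Set (affineWeylGroup P)} {a : SimpleAffineRoot b}
  (hI : IsTranslationDomain F b I a)
include hI

theorem mem_iff_of_coset_eq {x y : affineWeylGroup P}
    (h : (y : affineWeylGroup P ⧸ simpleSubgroup a) = x) : y ∈ I ↔ x ∈ I := by
  rcases coset_eq_iff.mp h with rfl | rfl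
  · rfl
  · exact ⟨fun h => by simpa [mul_simpleReflection_cancel] using hI.mul_mem _ h, hI.mul_mem _⟩

/-- The edge e meets the edge between x and xs at its start x, and the closure properties of I put
both edges in I. The label of the latter is ± the reduction of xα, so GKM applies. -/
theorem smul_label_ne {e : AffineEdge b} (he : e.target ≠ e.source * simpleReflection b a)
    (ht : e.target ∈ I) (c : F) :
    c • (affineGraph F b).label e ≠ reduceWeight F (weightAct P e.source (simpleWeight b a)) := by
  have hs := hI.source_mem e ht
  have hs' := hI.mul_mem _ hs
  obtain ⟨d, hd⟩ := exists_edge_mul_simpleReflection e.source a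
  have hne : e ≠ d := by
    rintro rfl
    rcases hd with ⟨-, h⟩ | ⟨-, h⟩
    · exact he h
    · exact e.source_ne_target h.symm
  have h1 : (affineGraph F b).label d =
      reduceWeight F (weightAct P e.source (simpleWeight b a)) ∨
      (affineGraph F b).label d =
        -reduceWeight F (weightAct P e.source (simpleWeight b a)) := by
    rcases hd with ⟨h, h'⟩ | ⟨h, h'⟩
    · rw [← h] at h' ⊢
      rcases AffineEdge.toWeight_root h' with h2 | h2
      · exact Or.inl (by rw [← h2])
      · exact Or.inr (by rw [← reduceWeight_neg, ← h2])
    · have h3 : weightAct P e.source (simpleWeight b a) =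
          -weightAct P d.source (simpleWeight b a) := by
        rw [h, weightAct_simpleReflection_mul, neg_neg]
      have h4 : d.target = d.source * simpleReflection b a := by
        rw [h, h', mul_simpleReflection_cancel]
      rw [h3, reduceWeight_neg, neg_neg]
      rcases AffineEdge.toWeight_root h4 with h2 | h2
      · exact Or.inr (by rw [← h2])
      · exact Or.inl (by rw [← reduceWeight_neg, ← h2])
  have h2 := hI.gkm e d hne hs ht (by rcases hd with ⟨h, -⟩ | ⟨h, -⟩ <;> simp only [h, hs, hs'])
    (by rcases hd with ⟨-, h⟩ | ⟨-, h⟩ <;> simp only [h, hs, hs'])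
    (by rcases hd with ⟨h, -⟩ | ⟨-, h⟩
        · exact Or.inl h.symm
        · exact Or.inr (Or.inl h.symm))
  rcases h1 with h1 | h1
  · rw [← h1]
    exact (h2 c).symm
  · intro h3
    rw [← h3] at h1
    exact h2 (-c) (by rw [h1, neg_smul])

/-- A global section of `ϑ^s M` has the form `g + c^α h`, where `g` and `h` are global sections
of `M`. -/
theorem exists_eq_add_of_mem_globalSections_theta {M : Sheaf (affineGraph F b)}
    (hM : M.IsTranslatable I) (m : ∀ x, (theta a M).stalk x) :
    m ∈ (theta a M).globalSections → ∃ g h : M.globalSections, ∀ (x y : affineWeylGroup P)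
      (hy : (y : affineWeylGroup P ⧸ simpleSubgroup a) = x), thetaProj M x y hy (m x) =
        g.1 y + weightFunction F (simpleWeight b a) x • h.1 y := by
  rw [mem_globalSections_theta_iff hM.range_onSrc_le]
  let α := weightFunction F (simpleWeight b a)
  have hα (x : affineWeylGroup P) : α (x * simpleReflection b a) = -α x :=
    weightFunction_mul_simpleReflection a x
  rintro ⟨hin, hout⟩
  have hxs (x : affineWeylGroup P) : ((x * simpleReflection b a : affineWeylGroup P) :
    affineWeylGroup P ⧸ simpleSubgroup a) = x := coset_mul_simpleReflection x a
  -- The half difference of m_x and m_{xs} is xα times a section over the coset. The edge condition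
  -- says this up to a sign, which depends on which of the two vertices is the lower one.
  have hk (x : affineWeylGroup P) :
      ∃ k : OnStalk M (x : affineWeylGroup P ⧸ simpleSubgroup a),
        ∀ (y : affineWeylGroup P) (hy : (y : affineWeylGroup P ⧸ simpleSubgroup a) = x),
          α x • k.1 ⟨y, hy⟩ = half F P • (thetaProj M x y hy (m x) -
            thetaProj M (x * simpleReflection b a) y (hy.trans (hxs x).symm)
              (m (x * simpleReflection b a))) := by
    obtain ⟨e, ⟨h1, h2⟩ | ⟨h1, h2⟩⟩ := exists_edge_mul_simpleReflection x a
    · subst h1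
      obtain ⟨k, hk⟩ := hin e h2
      have hε : ∃ ε : SymAlg F P, α e.source * ε = (affineGraph F b).slabel e := by
        rcases weightFunction_eq_slabel (F := F) h2 with h | h
        · exact ⟨1, by simp [α, h]⟩
        · exact ⟨-1, by simp [α, h]⟩
      obtain ⟨ε, hε⟩ := hε
      refine ⟨half F P • ε • k, fun y hy => ?_⟩
      change α e.source • half F P • ε • k.1 ⟨y, hy⟩ = _
      rw [smul_comm, smul_smul (α e.source), hε, ← hk y hy]
      congr 2
      exact thetaProj_congr m h2 _ _
    · have h3 : e.target = e.source * simpleReflection b a := by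
        rw [h1, h2, mul_simpleReflection_cancel]
      obtain ⟨k, hk⟩ := hin e h3
      have hε : ∃ ε : SymAlg F P, α x * ε = -(affineGraph F b).slabel e := by
        have h4 : α x = -α e.source := by rw [h1, hα, neg_neg]
        rw [h4]
        rcases weightFunction_eq_slabel (F := F) h3 with h | h
        · exact ⟨1, by simp [α, h]⟩
        · exact ⟨-1, by simp [α, h]⟩
      obtain ⟨ε, hε⟩ := hε
      have hc : (e.source : affineWeylGroup P ⧸ simpleSubgroup a) = x := by rw [h1, hxs]
      have hk' : ∀ (y : affineWeylGroup P)
          (hy : (y : affineWeylGroup P ⧸ simpleSubgroup a) = e.source),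
          -(affineGraph F b).slabel e • k.1 ⟨y, hy⟩ =
            thetaProj M x y (hy.trans hc) (m x) -
            thetaProj M (x * simpleReflection b a) y ((hy.trans hc).trans (hxs x).symm)
              (m (x * simpleReflection b a)) := by
        intro y hy
        rw [neg_smul, ← hk y hy, neg_sub]
        congr 1
        · exact thetaProj_congr m h2 _ _
        · exact thetaProj_congr m h1 _ _
      -- Here k is a section over the coset of xs, which equals that of x only propositionally.
      have hcast : ∀ (c : affineWeylGroup P ⧸ simpleSubgroup a) (hc : (e.source :
          affineWeylGroup P ⧸ simpleSubgroup a) = c), ∃ k' : OnStalk M c,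
          ∀ (y : affineWeylGroup P) (hy : (y : affineWeylGroup P ⧸ simpleSubgroup a) = c),
            k'.1 ⟨y, hy⟩ = k.1 ⟨y, hy.trans hc.symm⟩ := by
        rintro _ rfl
        exact ⟨k, fun _ _ => rfl⟩
      obtain ⟨k', hk''⟩ := hcast _ hc
      refine ⟨half F P • ε • k', fun y hy => ?_⟩
      change α x • half F P • ε • k'.1 ⟨y, hy⟩ = _
      rw [smul_comm, smul_smul (α x), hε, hk'', hk' y]
  choose k hk using hk
  let mv (x y : affineWeylGroup P)
    (hy : (y : affineWeylGroup P ⧸ simpleSubgroup a) = x) := thetaProj M x y hy (m x)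
  have mv_congr {x x' y : affineWeylGroup P} (hx : x = x')
      (h : (y : affineWeylGroup P ⧸ simpleSubgroup a) = x)
      (h' : (y : affineWeylGroup P ⧸ simpleSubgroup a) = x') : mv x y h = mv x' y h' :=
    thetaProj_congr m hx h h'
  -- Exchanging x and xs negates both xα and the difference, so the quotient is unchanged; torsion
  -- freeness allows xα to be cancelled.
  have hk_eq (x y : affineWeylGroup P)
      (hy : (y : affineWeylGroup P ⧸ simpleSubgroup a) = x) :
      (k x).1 ⟨y, hy⟩ = (k y).1 ⟨y, rfl⟩ := by
    rcases coset_eq_iff.mp hy with rfl | rfl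
    · rfl
    · refine sub_eq_zero.mp (hM.torsionFree _ _ (reduceWeight_weightAct_ne_zero a x) _ ?_)
      change α x • _ = 0
      have h1 := hk (x * simpleReflection b a) _ rfl
      rw [hα, neg_smul, neg_eq_iff_eq_neg] at h1
      rw [smul_sub, h1, hk, sub_neg_eq_add, ← smul_add,
        thetaProj_congr m (mul_simpleReflection_cancel x a) _ (hxs x)]
      simp
  let g : ∀ x, M.stalk x := fun x => half F P •
    (mv x x rfl + mv (x * simpleReflection b a) x (hxs x).symm)
  let h : ∀ x, M.stalk x := fun x => (k x).1 ⟨x, rfl⟩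
  have hgh (x y : affineWeylGroup P)
      (hy : (y : affineWeylGroup P ⧸ simpleSubgroup a) = x) :
      mv x y hy = g y + α x • h y := by
    have h1 : α x • h y = half F P • (mv x y hy -
        mv (x * simpleReflection b a) y (hy.trans (hxs x).symm)) := by
      rw [← hk x y hy, hk_eq]
    have h2 : g y = half F P • (mv x y hy +
        mv (x * simpleReflection b a) y (hy.trans (hxs x).symm)) := by
      rcases coset_eq_iff.mp hy with rfl | rfl
      · rfl
      · simp only [g]
        rw [add_comm, mv_congr (mul_simpleReflection_cancel x a) _ (hxs x)]
    rw [h1, h2, ← smul_add, add_add_sub_cancel, smul_add, half_smul_add_half_smul]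
  -- Inside a coset, g and h come from stalk elements of ϑ_on M, which are sections over the coset
  -- by definition.
  have hin' (e : AffineEdge b) (he : e.target = e.source * simpleReflection b a) :
      M.resSrc e (g e.source) = M.resTgt e (g e.target) ∧
        M.resSrc e (h e.source) = M.resTgt e (h e.target) := by
    have hc : (e.source : affineWeylGroup P ⧸ simpleSubgroup a) = e.target :=
      e.coset_eq_iff.mpr he
    constructor
    · have h1 : mv (e.source * simpleReflection b a) e.source (hxs _).symm =
          mv e.target e.source hc := mv_congr he.symm _ _
      have h2 : mv (e.target * simpleReflection b a) e.target (hxs _).symm =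
          mv e.source e.target hc.symm :=
        mv_congr (by rw [he, mul_simpleReflection_cancel]) _ _
      have h3 : M.resSrc e (mv e.source e.source rfl) = M.resTgt e (mv e.source e.target hc.symm) :=
        thetaProj_section (m e.source) e rfl hc.symm
      have h4 : M.resSrc e (mv e.target e.source hc) = M.resTgt e (mv e.target e.target rfl) :=
        thetaProj_section (m e.target) e hc rfl
      simp only [g, h1, h2]
      rw [map_smul, map_smul, map_add, map_add, h3, h4, add_comm]
    · have h1 : h e.target = (k e.source).1 ⟨e.target, hc.symm⟩ := (hk_eq e.source e.target hc.symm).symm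
      rw [h1]
      exact (k e.source).2 e rfl hc.symm
  -- The edges e and es have the same image in the quotient graph. So the condition on m along es
  -- may be read on e, where it compares the components of m_{xs} and m_{ys} at x and y.
  have hout' (e : AffineEdge b) (he : e.target ≠ e.source * simpleReflection b a) :
      M.resSrc e (mv e.source e.source rfl) = M.resTgt e (mv e.target e.target rfl) ∧
        M.resSrc e (mv (e.source * simpleReflection b a) e.source (hxs _).symm) =
          M.resTgt e (mv (e.target * simpleReflection b a) e.target (hxs _).symm) := by
    refine ⟨hout e he e rfl rfl rfl, ?_⟩
    obtain ⟨e', hr, hs, ht⟩ := AffineEdge.exists_mul_simpleReflection he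
    have h1 := hout e' (by rw [hs, ht]; simpa using he) e (by rw [hs, hxs]) (by rw [ht, hxs])
      hr.symm
    have h2 := mv_congr hs (by rw [hs, hxs]) (hxs e.source).symm
    have h3 := mv_congr ht (by rw [ht, hxs]) (hxs e.target).symm
    rw [← h2, ← h3]
    exact h1
  refine ⟨⟨g, fun e => ?_⟩, ⟨h, fun e => ?_⟩, hgh⟩
  · by_cases he : e.target = e.source * simpleReflection b a
    · exact (hin' e he).1
    · obtain ⟨h1, h2⟩ := hout' e he
      change M.resSrc e (half F P • _) = M.resTgt e (half F P • _)
      rw [map_smul, map_smul, map_add, map_add, h1, h2]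
  · by_cases he : e.target = e.source * simpleReflection b a
    · exact (hin' e he).2
    -- The known relation is the one for c^α h, the half difference of m_x and m_{xs}. For an edge
    -- in I, GKM lets xα be cancelled in the edge module; if the end lies outside I, the edge module
    -- is zero.
    · by_cases ht : e.target ∈ I
      · refine sub_eq_zero.mp (hM.edge_eq_zero_of_smul_eq_zero (hI.smul_label_ne he ht) ?_)
        change α e.source • _ = 0
        have h0 : α e.source • M.resTgt e (h e.target) = M.resTgt e (α e.target • h e.target) := by
          obtain ⟨c, hc⟩ := Ideal.mem_span_singleton'.mp
            (weightFunction_sub_mem (F := F) (simpleWeight b a) e)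
          rw [map_smul, ← sub_eq_zero, ← sub_smul, ← hc, mul_smul, M.label_smul, smul_zero]
        obtain ⟨h1, h2⟩ := hout' e he
        have h3 : M.resSrc e (α e.source • h e.source) =
            M.resTgt e (α e.target • h e.target) := by
          rw [hk, hk]
          change M.resSrc e (half F P • (mv _ _ _ - mv _ _ _)) =
            M.resTgt e (half F P • (mv _ _ _ - mv _ _ _))
          rw [map_smul, map_smul, map_sub, map_sub, h1, h2]
        rw [smul_sub, ← map_smul]
        erw [h0, h3]
        exact sub_self _
      · exact (hM.edge_eq_zero_of_notMem ht _).trans (hM.edge_eq_zero_of_notMem ht _).symm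

end IsTranslationDomain

/-- If `g` and `h` are global sections of `M` then `g + c^α h` is a global section of `ϑ^s M`. -/
theorem mem_globalSections_theta_of_eq_add {I : Set (affineWeylGroup P)}
    {a : SimpleAffineRoot b} {M : Sheaf (affineGraph F b)}
    (hM : M.IsTranslatable I) (m : ∀ x, (theta a M).stalk x) :
    (∃ g h : M.globalSections, ∀ (x y : affineWeylGroup P)
      (hy : (y : affineWeylGroup P ⧸ simpleSubgroup a) = x), thetaProj M x y hy (m x) =
        g.1 y + weightFunction F (simpleWeight b a) x • h.1 y) →
      m ∈ (theta a M).globalSections := by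
  rw [mem_globalSections_theta_iff hM.range_onSrc_le]
  let α := weightFunction F (simpleWeight b a)
  have hα (x : affineWeylGroup P) : α (x * simpleReflection b a) = -α x :=
    weightFunction_mul_simpleReflection a x
  rintro ⟨g, h, hgh⟩
  refine ⟨fun e he => ?_, fun e he e' hs ht hr => ?_⟩
  -- The g-parts cancel between x and xs, leaving 2xα · h, a multiple of the label.
  · have hε : ∃ ε : SymAlg F P, α e.source + α e.source = (affineGraph F b).slabel e * ε := by
      rcases weightFunction_eq_slabel (F := F) he with h | h
      · exact ⟨2, by simp [α, h]; ring⟩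
      · exact ⟨-2, by simp [α, h]; ring⟩
    obtain ⟨ε, hε⟩ := hε
    refine ⟨ε • Sheaf.restrictSection _ h, fun y hy => ?_⟩
    change _ = _ • ε • h.1 y
    rw [hgh, hgh, smul_smul, ← hε, add_sub_add_left_eq_sub, ← sub_smul]
    congr 1
    change α e.source - α e.target = _
    rw [he, hα, sub_neg_eq_add]
  · rw [hgh, hgh, ← sub_eq_zero]
    obtain ⟨c, hc⟩ := Ideal.mem_span_singleton'.mp
      (weightFunction_sub_mem (F := F) (simpleWeight b a) e)
    have hl : (affineGraph F b).slabel e = (affineGraph F b).slabel e' := by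
      simp only [LabelledGraph.slabel, hr]
    have h1 := g.2 e'
    have h2 := h.2 e'
    have h3 : (weightFunction F (simpleWeight b a) e.source -
        weightFunction F (simpleWeight b a) e.target) • M.resTgt e' (h.1 e'.target) = 0 := by
      rw [← hc, mul_smul, hl, M.label_smul, smul_zero]
    rw [map_add, map_add, map_smul, map_smul]
    erw [h1, h2]
    rw [add_sub_add_left_eq_sub, ← sub_smul]
    exact h3


end Translation

/-! ### Bott-Samelson sheaves are translatable -/

section Translation

variable {F : Type u} [Field F] [NeZero (2 : F)]
variable {ι V N : Type v} [Finite ι] [AddCommGroup V] [Module ℚ V] [AddCommGroup N] [Module ℚ N]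
variable {P : RootPairing ι ℚ V N} [P.IsCrystallographic] [P.IsRootSystem] [P.IsReduced]
  [P.IsIrreducible] {b : P.Base}

theorem stalkCast_surjective {G : LabelledGraph.{u, v} F (LabelSpace F P)} (M : Sheaf G)
    {x y : G.V} (h : x = y) : Function.Surjective (stalkCast M h) := by
  subst h
  exact Function.surjective_id

theorem exists_eq_smul_of_stalkCast_eq {G : LabelledGraph.{u, v} F (LabelSpace F P)} (M : Sheaf G)
    {x y : G.V} (h : x = y) {r : SymAlg F P} {m : M.stalk x} {k : M.stalk y}
    (hm : stalkCast M h m = r • k) : ∃ n, m = r • n := by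
  subst h
  exact ⟨k, hm⟩

theorem thetaOut_resTgt_surjective {H : Subgroup (affineWeylGroup P)}
    (M : Sheaf (quotientGraph F b H)) (hM : ∀ e, Function.Surjective (M.resTgt e))
    (e : AffineEdge b) : Function.Surjective ((outDatum M e).fromTgt) := by
  by_cases h : (e.source : affineWeylGroup P ⧸ H) = e.target
  · rw [show outDatum M e = outInner M e h from dif_pos h]
    exact (Submodule.mkQ_surjective _).comp (stalkCast_surjective M h.symm)
  · rw [show outDatum M e = outOuter M e h from dif_neg h]
    exact hM _

namespace IsTranslationDomain

variable {I : Set (affineWeylGroup P)} {a : SimpleAffineRoot b}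
  (hI : IsTranslationDomain F b I a)
include hI

/-- The two components of q are divisible by the label of e, by the kernel condition for M at e and
at its translate es. The quotients form a section because, by GKM, this label can be cancelled in
the module of the edge inside the coset. -/
theorem exists_eq_smul_of_thetaOn_resTgt_eq_zero {M : Sheaf (affineGraph F b)}
    (hM : M.IsTranslatable I) {e : AffineEdge b}
    (he : e.target ≠ e.source * simpleReflection b a)
    (q : OnStalk M (e.target : affineWeylGroup P ⧸ simpleSubgroup a))
    (hq : ∀ (e' : AffineEdge b)
      (_ : (e'.source : affineWeylGroup P ⧸ simpleSubgroup a) = e.source)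
      (ht : (e'.target : affineWeylGroup P ⧸ simpleSubgroup a) = e.target),
      e'.root = e.root → M.resTgt e' (q.1 ⟨e'.target, ht⟩) = 0) :
    ∃ n : OnStalk M (e.target : affineWeylGroup P ⧸ simpleSubgroup a),
      q = (affineGraph F b).slabel e • n := by
  by_cases ht : e.target ∈ I
  swap
  · refine ⟨0, Subtype.ext (funext fun y => ?_)⟩
    rw [smul_zero]
    exact hM.supported _ (fun hy => ht ((hI.mem_iff_of_coset_eq y.2).mp hy)) _
  have hn (y : cosetFibre (simpleSubgroup a)
      (e.target : affineWeylGroup P ⧸ simpleSubgroup a)) :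
      ∃ n : M.stalk y.1, q.1 y = (affineGraph F b).slabel e • n := by
    obtain ⟨y, hy⟩ := y
    rcases coset_eq_iff.mp
      (show (y : affineWeylGroup P ⧸ simpleSubgroup a) = e.target from hy) with rfl | rfl
    · exact hM.ker_resTgt e _ (hq e rfl rfl rfl)
    · obtain ⟨e', hr, hs, ht⟩ := AffineEdge.exists_mul_simpleReflection he
      have key : ∀ z (hz : e'.target = z) (hz' : z ∈ cosetFibre (simpleSubgroup a)
          (e.target : affineWeylGroup P ⧸ simpleSubgroup a)),
          ∃ n : M.stalk z, q.1 ⟨z, hz'⟩ = (affineGraph F b).slabel e • n := by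
        rintro _ rfl hz'
        have hl : (affineGraph F b).slabel e = (affineGraph F b).slabel e' := by
          simp only [LabelledGraph.slabel, hr]
        rw [hl]
        exact hM.ker_resTgt e' _ (hq e' (by rw [hs, coset_mul_simpleReflection]) _ hr)
      exact key _ ht hy
  choose n hn using hn
  -- The edge d joins the two elements of the coset of `e.target`; hence it meets e at that vertex.
  refine ⟨⟨n, hM.mem_sectionsOn_of_smul fun d hds hdt =>
    ⟨(affineGraph F b).label e, fun c hc => ?_, ?_⟩⟩, Subtype.ext (funext hn)⟩
  · have hds' : (d.source : affineWeylGroup P ⧸ simpleSubgroup a) = e.target := hds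
    have hdt' : (d.target : affineWeylGroup P ⧸ simpleSubgroup a) = e.target := hdt
    refine hI.gkm d e ?_ ((hI.mem_iff_of_coset_eq hds').mpr ht)
      ((hI.mem_iff_of_coset_eq hdt').mpr ht) (hI.source_mem e ht) ht ?_ c hc.symm
    · rintro rfl
      exact he (d.coset_eq_iff.mp hds')
    · rcases coset_eq_iff.mp hds' with h | h
      · exact Or.inr (Or.inl h)
      · refine Or.inr (Or.inr (Or.inr ?_))
        rcases coset_eq_iff.mp hdt' with h' | h'
        · exact h'
        · exact absurd (h.trans h'.symm) d.source_ne_target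
  · have h1 := q.2 d hds hdt
    rw [hn, hn] at h1
    exact h1

/-- Translation functors preserve translatable sheaves. -/
theorem isTranslatable_theta {M : Sheaf (affineGraph F b)} (hM : M.IsTranslatable I) :
    (theta a M).IsTranslatable I where
  supported x hx m := by
    have key (m : OnStalk M (x : affineWeylGroup P ⧸ simpleSubgroup a)) : m = 0 :=
      Subtype.ext (funext fun y => hM.supported _
        (fun hy => hx ((hI.mem_iff_of_coset_eq y.2).mp hy)) _)
    exact key m
  torsionFree x β hβ m hm := hM.sectionsOn_torsionFree hβ hm
  regular x β γ hγ hβγ m m' hm := hM.sectionsOn_regular hγ hβγ hm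
  surjective e := thetaOut_resTgt_surjective (thetaOn (simpleSubgroup a) M)
    (fun e => LinearMap.surjective_rangeRestrict (onTgt M e)) e
  ker_resTgt e q hq := by
    have hq' : (outDatum (thetaOn (simpleSubgroup a) M) e).fromSrc 0 =
        (outDatum (thetaOn (simpleSubgroup a) M) e).fromTgt q := (map_zero _).trans hq.symm
    by_cases h : (e.source : affineWeylGroup P ⧸ simpleSubgroup a) = e.target
    · obtain ⟨k, hk⟩ := (outDatum_inner_iff _ e h _ _).mp hq'
      refine exists_eq_smul_of_stalkCast_eq (thetaOn (simpleSubgroup a) M) h.symm (k := -k) ?_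
      rw [smul_neg, ← hk, zero_sub, neg_neg]
    · have h1 := (thetaOn_res_eq_iff M (quotientEdgeOf e h) (hM.range_onSrc_le _) _ _).mp
        ((outDatum_outer_iff _ e h _ _).mp hq')
      refine hI.exists_eq_smul_of_thetaOn_resTgt_eq_zero hM
        (fun h' => h (e.coset_eq_iff.mpr h')) q fun e' hs ht hr => ?_
      exact (h1 ⟨e', hs, ht, hr⟩).symm.trans (map_zero _)
  exists_section x m := by
    obtain ⟨g, hg⟩ := hM.exists_section_coset (a := a) (x : affineWeylGroup P ⧸ simpleSubgroup a) m
    -- A global section g of M is one of ϑ^s M through its restrictions to the cosets: the case h =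
    -- 0 of g + c^α h.
    refine ⟨⟨fun y => Sheaf.restrictSection (cosetFibre (simpleSubgroup a)
      (y : affineWeylGroup P ⧸ simpleSubgroup a)) g,
      mem_globalSections_theta_of_eq_add hM _ ⟨g, 0, fun y z hz => ?_⟩⟩, hg⟩
    change g.1 z = g.1 z + _ • (0 : M.stalk z)
    rw [smul_zero, add_zero]

end IsTranslationDomain

theorem skyscraper_stalk_eq_zero {x : affineWeylGroup P} (hx : x ≠ 1)
    (m : (skyscraper F b).stalk x) : m = 0 := by
  obtain ⟨m, hm⟩ := m
  have hm' := hm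
  rw [if_neg hx, Submodule.mem_bot] at hm'
  exact Subtype.ext hm'

/-- The zero edge modules satisfy the kernel condition because no edge ends at 1, so the stalks at
ends of edges vanish. Regularity at 1 is divisibility by linear forms in S. -/
theorem isTranslatable_skyscraper {I : Set (affineWeylGroup P)} (hI : 1 ∈ I) :
    (skyscraper F b).IsTranslatable I := by
  constructor
  · intro x hx m
    exact skyscraper_stalk_eq_zero (ne_of_mem_of_not_mem hI hx).symm m
  · intro x β hβ m hm
    have h1 := congrArg Subtype.val hm
    exact Subtype.ext ((mul_eq_zero.mp h1).resolve_left (SymmetricAlgebra.ι_ne_zero hβ))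
  · intro x β γ hγ hβγ m m' hm
    by_cases hx : x = 1
    · obtain ⟨c, hc⟩ := SymmetricAlgebra.ι_dvd_of_ι_mul_eq hγ hβγ (congrArg Subtype.val hm)
      exact ⟨⟨c, by rw [if_pos hx]; trivial⟩, Subtype.ext hc⟩
    · exact ⟨0, by rw [smul_zero]; exact skyscraper_stalk_eq_zero hx m⟩
  · intro e m
    exact ⟨0, rfl⟩
  · intro e m _
    exact ⟨0, by rw [smul_zero]; exact skyscraper_stalk_eq_zero e.target_ne_one m⟩
  · intro x m
    classical
    exact ⟨⟨Pi.single x m, fun e => rfl⟩, Pi.single_eq_same x m⟩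

theorem isTranslationDomain_J {l : ℕ} (s : Fin (l + 1) → SimpleAffineRoot b)
    (h : (affineGraph F b).IsGKMOn (J s)) :
    IsTranslationDomain F b (J s) (s (Fin.last l)) where
  source_mem _ := AffineEdge.source_mem_J
  mul_mem _ := mul_mem_J
  gkm := h

theorem isGKMOn_mono {I I' : Set (affineWeylGroup P)} (hI : I ⊆ I')
    (h : (affineGraph F b).IsGKMOn I') : (affineGraph F b).IsGKMOn I :=
  fun e e' hne h1 h2 h3 h4 => h e e' hne (hI h1) (hI h2) (hI h3) (hI h4)

theorem one_mem_J : ∀ {l : ℕ} (s : Fin l → SimpleAffineRoot b), (1 : affineWeylGroup P) ∈ J s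
  | 0, _ => ⟨Fin.elim0, by simp [ev]⟩
  | _ + 1, s => mem_J_of_mem_J_init (one_mem_J (Fin.init s))

/-- Needed in the induction: the sheaf of the truncated sequence s' is supported on J(s'), but the
set stable under right multiplication by the last reflection is J(s). -/
theorem isTranslatable_mono {M : Sheaf (affineGraph F b)} {I I' : Set (affineWeylGroup P)}
    (hI : I ⊆ I') (hM : M.IsTranslatable I) : M.IsTranslatable I' :=
  { hM with supported := fun x hx => hM.supported x fun h => hx (hI h) }

/-- The Bott-Samelson sheaves are translatable. -/
theorem isTranslatable_bottSamelson : ∀ {l : ℕ} (s : Fin l → SimpleAffineRoot b),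
    (affineGraph F b).IsGKMOn (J s) → (bottSamelson F b s).IsTranslatable (J s)
  | 0, s, _ => isTranslatable_skyscraper (one_mem_J s)
  | _ + 1, s, h => (isTranslationDomain_J s h).isTranslatable_theta
      (isTranslatable_mono (fun _ => mem_J_of_mem_J_init)
        (isTranslatable_bottSamelson (Fin.init s)
          (isGKMOn_mono (fun _ => mem_J_of_mem_J_init) h)))

end Translation

/-! ### Bott-Samelson stalks and sections as functions on subsequences -/

section Embedding

variable {F : Type u} [Field F] [NeZero (2 : F)]
variable {ι V N : Type v} [Finite ι] [AddCommGroup V] [Module ℚ V] [AddCommGroup N] [Module ℚ N]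
variable {P : RootPairing ι ℚ V N} [P.IsCrystallographic] [P.IsRootSystem] [P.IsReduced]
  [P.IsIrreducible] {b : P.Base}

theorem mem_fiebigModule_succ_iff {l : ℕ} (s : Fin (l + 1) → SimpleAffineRoot b)
    (f : Subseq (l + 1) → SymAlg F P) :
    f ∈ fiebigModule F s ↔ ∃ g ∈ fiebigModule F (Fin.init s), ∃ h ∈ fiebigModule F (Fin.init s),
      ∀ σ, f σ = g (Fin.init σ) +
        weightFunction F (simpleWeight b (s (Fin.last l))) (ev s σ) * h (Fin.init σ) := by
  rw [fiebigModule, Submodule.mem_sup]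
  constructor
  · rintro ⟨_, ⟨g, hg, rfl⟩, _, ⟨_, ⟨h, hh, rfl⟩, rfl⟩, rfl⟩
    exact ⟨g, hg, h, hh, fun σ => rfl⟩
  · rintro ⟨g, hg, h, hh, hf⟩
    exact ⟨_, ⟨g, hg, rfl⟩, _, ⟨_, ⟨h, hh, rfl⟩, rfl⟩, (funext hf).symm⟩

theorem coset_ev_init {l : ℕ} (s : Fin (l + 1) → SimpleAffineRoot b) (σ : Subseq (l + 1)) :
    (ev (Fin.init s) (Fin.init σ) : affineWeylGroup P ⧸ simpleSubgroup (s (Fin.last l))) =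
      ev s σ := by
  rw [ev_succ]
  split_ifs
  · rw [coset_mul_simpleReflection]
  · rw [mul_one]

/-- The embedding of the stalk of a Bott-Samelson sheaf into the functions on the subsequences. -/
def stalkEmbedding (F : Type u) [Field F] [NeZero (2 : F)] : ∀ {l : ℕ}
    (s : Fin l → SimpleAffineRoot b) (x : affineWeylGroup P),
    (bottSamelson F b s).stalk x →ₗ[SymAlg F P] ({σ : Subseq l // ev s σ = x} → SymAlg F P)
  | 0, _, _ => LinearMap.pi fun _ => Submodule.subtype _
  | _ + 1, s, x => LinearMap.pi fun σ =>
      LinearMap.proj ⟨Fin.init σ.1, rfl⟩ ∘ₗ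
        stalkEmbedding F (Fin.init s) (ev (Fin.init s) (Fin.init σ.1)) ∘ₗ
          thetaProj _ x _ ((coset_ev_init s σ.1).trans (congrArg _ σ.2))

/-- Every subsequence of s' with product in {x, xs} is the truncation of one of s with product x: a
blank or the last reflection is appended. Thus all coordinates of both components of a stalk element
at x are seen, and induction applies. -/
theorem stalkEmbedding_injective : ∀ {l : ℕ} (s : Fin l → SimpleAffineRoot b)
    (x : affineWeylGroup P), Function.Injective (stalkEmbedding F s x)
  | 0, s, x => by
    rw [injective_iff_map_eq_zero]
    intro m hm
    by_cases hx : x = 1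
    · have h1 : ev s (Fin.elim0 : Subseq 0) = x := by simp [ev, hx]
      exact Subtype.ext (congrFun hm ⟨_, h1⟩)
    · exact skyscraper_stalk_eq_zero hx m
  | l + 1, s, x => by
    rw [injective_iff_map_eq_zero]
    intro m hm
    have key : ∀ (y : affineWeylGroup P) (hy : (y : affineWeylGroup P ⧸
        simpleSubgroup (s (Fin.last l))) = x), thetaProj (bottSamelson F b (Fin.init s)) x y hy m = 0 := by
      intro y hy
      refine (injective_iff_map_eq_zero _).mp (stalkEmbedding_injective (Fin.init s) y) _
        (funext fun σ => ?_)
      obtain ⟨σ, rfl⟩ := σ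
      obtain ⟨τ, hτ, rfl⟩ : ∃ τ : Subseq (l + 1), ev s τ = x ∧ Fin.init τ = σ := by
        rcases coset_eq_iff.mp hy.symm with h | h
        · exact ⟨Fin.snoc σ false, by simp [ev_snoc, h], Fin.init_snoc _ _⟩
        · exact ⟨Fin.snoc σ true, by simp [ev_snoc, h], Fin.init_snoc _ _⟩
      exact congrFun hm ⟨τ, hτ⟩
    exact Subtype.ext (funext fun y => key y.1 y.2)

/-- The function on the subsequences given by a family of elements of the stalks. -/
def sectionEmbedding (F : Type u) [Field F] [NeZero (2 : F)] {l : ℕ}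
    (s : Fin l → SimpleAffineRoot b) :
    (∀ x, (bottSamelson F b s).stalk x) →ₗ[SymAlg F P] (Subseq l → SymAlg F P) :=
  LinearMap.pi fun σ => LinearMap.proj ⟨σ, rfl⟩ ∘ₗ stalkEmbedding F s (ev s σ) ∘ₗ LinearMap.proj _

theorem restrictTo_sectionEmbedding {l : ℕ} (s : Fin l → SimpleAffineRoot b)
    (m : ∀ x, (bottSamelson F b s).stalk x) (x : affineWeylGroup P) :
    restrictTo F s x (sectionEmbedding F s m) = stalkEmbedding F s x (m x) := by
  funext σ
  obtain ⟨σ, rfl⟩ := σ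
  rfl

theorem sectionEmbedding_injective {l : ℕ} (s : Fin l → SimpleAffineRoot b) :
    Function.Injective (sectionEmbedding F s) := fun m m' h => funext fun x =>
  stalkEmbedding_injective s x (by
    rw [← restrictTo_sectionEmbedding, h, restrictTo_sectionEmbedding])

/-- The image of the global sections of the Bott-Samelson sheaf is the module `X(s)`. -/
theorem mem_fiebigModule_iff : ∀ {l : ℕ} (s : Fin l → SimpleAffineRoot b),
    (affineGraph F b).IsGKMOn (J s) → ∀ f, f ∈ fiebigModule F s ↔
      ∃ m ∈ (bottSamelson F b s).globalSections, sectionEmbedding F s m = f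
  | 0, s, _, f => by
    classical
    refine iff_of_true trivial ⟨fun x => ⟨if x = 1 then f Fin.elim0 else 0, ?_⟩,
      fun e => rfl, funext fun σ => ?_⟩
    · split_ifs <;> simp
    · have h1 : ev s σ = 1 := by simp [ev]
      exact (if_pos h1).trans (congrArg f (Subsingleton.elim _ _))
  | l + 1, s, hG, f => by
    have hG' : (affineGraph F b).IsGKMOn (J (Fin.init s)) :=
      isGKMOn_mono (fun _ => mem_J_of_mem_J_init) hG
    have hM := isTranslatable_mono (I' := J s) (fun _ => mem_J_of_mem_J_init)
      (isTranslatable_bottSamelson (F := F) (Fin.init s) hG')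
    have hI := isTranslationDomain_J s hG
    have ih := mem_fiebigModule_iff (Fin.init s) hG'
    rw [mem_fiebigModule_succ_iff]
    constructor
    · rintro ⟨u, hu, v, hv, huv⟩
      obtain ⟨g, hg, rfl⟩ := (ih u).mp hu
      obtain ⟨h, hh, rfl⟩ := (ih v).mp hv
      let m : ∀ x, (theta (s (Fin.last l)) (bottSamelson F b (Fin.init s))).stalk x := fun x =>
        Sheaf.restrictSection (cosetFibre (simpleSubgroup (s (Fin.last l))) _)
          (⟨g, hg⟩ : (bottSamelson F b (Fin.init s)).globalSections) +
        weightFunction F (simpleWeight b (s (Fin.last l))) x •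
          Sheaf.restrictSection (cosetFibre (simpleSubgroup (s (Fin.last l)))
            (x : affineWeylGroup P ⧸ simpleSubgroup (s (Fin.last l))))
            (⟨h, hh⟩ : (bottSamelson F b (Fin.init s)).globalSections)
      have hgh : ∀ (x y : affineWeylGroup P) (hy : (y : affineWeylGroup P ⧸
          simpleSubgroup (s (Fin.last l))) = x), thetaProj _ x y hy (m x) =
            g y + weightFunction F (simpleWeight b (s (Fin.last l))) x • h y := fun x y hy => rfl
      refine ⟨m, mem_globalSections_theta_of_eq_add hM m ⟨⟨g, hg⟩, ⟨h, hh⟩, hgh⟩,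
        funext fun σ => ?_⟩
      rw [huv]
      -- The coordinate at σ reads the component at ev(σ') of the stalk element at ev(σ). So c^α is
      -- evaluated at ev(σ) while g and h are evaluated at ev(σ'), exactly as in the recursion for
      -- X(s).
      change stalkEmbedding F (Fin.init s) _ (thetaProj _ _ _ _ (m _)) _ = _
      rw [hgh, map_add, map_smul]
      rfl
    · rintro ⟨m, hm, rfl⟩
      obtain ⟨g, h, hgh⟩ := hI.exists_eq_add_of_mem_globalSections_theta hM m hm
      refine ⟨_, (ih _).mpr ⟨g.1, g.2, rfl⟩, _, (ih _).mpr ⟨h.1, h.2, rfl⟩, fun σ => ?_⟩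
      change stalkEmbedding F (Fin.init s) _ (thetaProj _ _ _ _ (m _)) _ = _
      rw [hgh, map_add, map_smul]
      rfl

end Embedding

end

end BottSamelson

/-! ### The isomorphisms of global sections and of stalks -/

theorem theorem3 {F : Type u} [Field F] [NeZero (2 : F)]
    {ι V N : Type v} [Finite ι] [AddCommGroup V] [Module ℚ V] [AddCommGroup N] [Module ℚ N]
    {P : RootPairing ι ℚ V N} [P.IsRootSystem] [P.IsCrystallographic] [P.IsReduced]
    [P.IsIrreducible] (b : P.Base) {l : ℕ} (s : Fin l → SimpleAffineRoot b)
    (hGKM : (affineGraph F b).IsGKMOn (J s)) :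
    ∃ hX : IsZStable F s,
      letI := fiebigZModule hX
      ∃ (φ : (bottSamelson F b s).globalSections
            ≃ₗ[structureAlgebra (affineGraph F b) (J s)] fiebigModule F s)
        (φx : ∀ x : affineWeylGroup P,
            (bottSamelson F b s).stalk x ≃ₗ[SymAlg F P] fiebigStalk F s x),
        ∀ (x : affineWeylGroup P) (m : (bottSamelson F b s).globalSections),
          φx x (m.1 x) = fiebigRestriction s x (φ m) := by
  have hZ (z : structureAlgebra (affineGraph F b) (J s)) (m : (bottSamelson F b s).globalSections) :
      sectionEmbedding F s (z • m).1 = zAct s z (sectionEmbedding F s m.1) := by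
    funext σ
    have h1 : (z • m).1 (ev s σ) = z.1 ⟨ev s σ, ev_mem_J s σ⟩ • m.1 (ev s σ) :=
      zsmul_of_mem (bottSamelson_supportedOn F s) z m (ev_mem_J s σ)
    change stalkEmbedding F s (ev s σ) ((z • m).1 (ev s σ)) _ = _
    rw [h1, map_smul]
    rfl
  -- Stability is inherited from the global sections, whose image under an embedding compatible with
  -- 𝒵(J(s)) is X(s).
  have hX : IsZStable F s := by
    intro z f hf
    obtain ⟨m, hm, rfl⟩ := (mem_fiebigModule_iff s hGKM f).mp hf
    exact (mem_fiebigModule_iff s hGKM _).mpr ⟨_, (z • ⟨m, hm⟩ :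
      (bottSamelson F b s).globalSections).2, hZ z ⟨m, hm⟩⟩
  refine ⟨hX, ?_⟩
  let _ := fiebigZModule hX
  let φ : (bottSamelson F b s).globalSections
      →ₗ[structureAlgebra (affineGraph F b) (J s)] fiebigModule F s :=
    { toFun := fun m => ⟨sectionEmbedding F s m.1, (mem_fiebigModule_iff s hGKM _).mpr ⟨_, m.2, rfl⟩⟩
      map_add' := fun m m' => Subtype.ext (map_add _ _ _)
      map_smul' := fun z m => Subtype.ext (hZ z m) }
  have hφ : Function.Bijective φ := by
    constructor
    · intro m m' h
      exact Subtype.ext (sectionEmbedding_injective s (congrArg Subtype.val h))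
    · rintro ⟨f, hf⟩
      obtain ⟨m, hm, rfl⟩ := (mem_fiebigModule_iff s hGKM f).mp hf
      exact ⟨⟨m, hm⟩, rfl⟩
  have hM := isTranslatable_bottSamelson (F := F) s hGKM
  -- A stalk element lands in X(s)^x because it is the value of a global section.
  have hmem (x : affineWeylGroup P) (m : (bottSamelson F b s).stalk x) :
      stalkEmbedding F s x m ∈ fiebigStalk F s x := by
    obtain ⟨g, rfl⟩ := hM.exists_section x m
    rw [← restrictTo_sectionEmbedding]
    exact Submodule.mem_map_of_mem ((mem_fiebigModule_iff s hGKM _).mpr ⟨_, g.2, rfl⟩)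
  have hφx (x : affineWeylGroup P) :
      Function.Bijective ((stalkEmbedding F s x).codRestrict (fiebigStalk F s x) (hmem x)) := by
    constructor
    · intro m m' h
      exact stalkEmbedding_injective s x (congrArg Subtype.val h)
    · rintro ⟨_, f, hf, rfl⟩
      obtain ⟨m, hm, rfl⟩ := (mem_fiebigModule_iff s hGKM f).mp hf
      exact ⟨m x, Subtype.ext (restrictTo_sectionEmbedding s m x).symm⟩
  exact ⟨LinearEquiv.ofBijective φ hφ, fun x => LinearEquiv.ofBijective _ (hφx x),
    fun x m => Subtype.ext (restrictTo_sectionEmbedding s m.1 x).symm⟩
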